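/- Conventions. A positive cone of a group $G$ is a subsemigroup $P\subseteq G$ such that $G=P\sqcup P^{-1}\sqcup\{1\}$; $G$ is left-orderable if it has a positive cone. For a finite generating set $X$ of $G$ let $\Gamma(G,X)$ be the Cayley graph and $\mathrm d_X$ its combinatorial metric. An $r$-path in $\Gamma(G,X)$ is a finite sequence of elements in which consecutive terms are at $\mathrm d_X$-distance at most $r$. A set $S\subseteq G$ $r$-disconnects two subsets $A,B\subseteq G$ if every $r$-path from a point of $A$ to a point of $B$ meets $S$. A left-orderable group $G$ is *Prieto* if it has a finite generating set $X$ such that every positive cone $P$ of $G$ is coarsely connected in $\Gamma(G,X)$, i.e. there is $r\ge 1$ such that any two elements of $P$ are joined by an $r$-path contained in $P$. A left-orderable group $G$ is *Hucha with respect to* a family $\mathcal H$ of subgroups (or with respect to $H$, if $\mathcal H=\{H\}$) if it has a finite generating set $X$ such that for every positive cone $P$ of $G$, every $H\in\mathcal H$ and every integer $r>0$ there is a subset $S\subseteq P^{-1}$ such that (1) $S$ $r$-disconnects $\{u\}$ and $\{w\}$ for some $u,w\in P$, and (2) $S$ $r$-disconnects $g_1H$ and $g_2H$ for some $g_1,g_2\in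 G$. (Neither property depends on the choice of $X$.) Trees are simplicial, and groups act on them by graph automorphisms without inversions. For a vertex $v$ (an edge $e$) of a tree, $G_v$ ($G_e$) is its stabilizer and $\mathrm{link}_T(v)$ is the set of edges adjacent to $v$. An end of a tree $T$ is a class of rays (semi-infinite paths without repetitions), two rays being equivalent if their intersection is infinite. An action of $G$ on $T$ is co-finite if there are finitely many orbits of vertices and edges; minimal if $T$ is the only $G$-invariant non-empty subtree; and of general type if $G$ fixes neither a vertex nor an end of $T$ and some vertex orbit accumulates at at least three different ends of $T$. A subgroup acts elliptically on $T$ if it fixes a vertex of $T$. **Theorem.** Let $G$ be a finitely generated left-orderable group with a co-finite, minimal, general type action on a tree $T$ all of whose vertex stabilizers are finitely generated. Let $v$ be a vertex of $T$, let $\mathcal P=\{G_e : e\in\mathrm{link}_T(v)\}$ and let $H\in\mathcal P$. Assume that $G_v$ is Hucha with respect to $H$ and that all the groups in $\mathcal P$ are Prieto. Then $G$ is Hucha with respect to the family consisting of all cyclic subgroups of $G$ and all subgroups of $G$ acting elliptically on $T$. -/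

import Mathlib

/-! ### Coarse connectedness in graphs -/

/-- `γ 0, …, γ n` is an `r`-path of the graph `Γ`: consecutive vertices are at combinatorial
distance at most `r`. Only the values of `γ` at `0, …, n` matter. -/
def IsRPath {W : Type*} (Γ : SimpleGraph W) (r n : ℕ) (γ : ℕ → W) : Prop :=
  ∀ i < n, Γ.edist (γ i) (γ (i + 1)) ≤ r

/-- `S` is coarsely connected in `Γ`. -/
def IsCoarselyConnected {W : Type*} (Γ : SimpleGraph W) (S : Set W) : Prop :=
  ∃ r : ℕ, 1 ≤ r ∧ ∀ u ∈ S, ∀ w ∈ S, ∃ (n : ℕ) (γ : ℕ → W),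
    IsRPath Γ r n γ ∧ γ 0 = u ∧ γ n = w ∧ ∀ i ≤ n, γ i ∈ S

/-- `S` `r`-disconnects the sets `A` and `B`: every `r`-path from `A` to `B` meets `S`. -/
def RDisconnects {W : Type*} (Γ : SimpleGraph W) (r : ℕ) (S A B : Set W) : Prop :=
  ∀ (n : ℕ) (γ : ℕ → W), IsRPath Γ r n γ → γ 0 ∈ A → γ n ∈ B → ∃ i ≤ n, γ i ∈ S

/-! ### Positive cones, and the Prieto and Hucha properties -/

/-- `P` is a positive cone of the group `G`: a subsemigroup such that `G` is the disjoint union of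
`P`, `P⁻¹` and `{1}`. -/
structure IsPositiveCone {G : Type*} [Group G] (P : Set G) : Prop where
  mul_mem : ∀ a ∈ P, ∀ b ∈ P, a * b ∈ P
  cover : ∀ g : G, g ∈ P ∨ g ∈ P⁻¹ ∨ g = 1
  disjoint_inv : Disjoint P P⁻¹
  one_notMem : (1 : G) ∉ P

/-- A group is left-orderable if it has a positive cone. -/
def IsLeftOrderable (G : Type*) [Group G] : Prop :=
  ∃ P : Set G, IsPositiveCone P

/-- `G` is Prieto: it is left-orderable and, for some finite generating set `X`, every positive
cone of `G` is coarsely connected in the Cayley graph of `G` with respect to `X`.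
(In `SimpleGraph.mulCayley X` the distinct elements `g` and `h` are adjacent when `h = g * x` or
`g = h * x` for some `x ∈ X`, so that `X` need not be symmetric.) -/
def IsPrieto (G : Type*) [Group G] : Prop :=
  IsLeftOrderable G ∧ ∃ X : Set G, X.Finite ∧ Subgroup.closure X = ⊤ ∧
    ∀ P : Set G, IsPositiveCone P → IsCoarselyConnected (SimpleGraph.mulCayley X) P

/-- `S` is a negative swamp of width `r` for the subgroup `H` in the Cayley graph of `G` with
respect to `X`, relative to the positive cone `P`. -/
structure IsNegativeSwamp {G : Type*} [Group G] (X P : Set G) (H : Subgroup G) (r : ℕ)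
    (S : Set G) : Prop where
  subset_inv : S ⊆ P⁻¹
  disconnects_cone : ∃ u ∈ P, ∃ w ∈ P, RDisconnects (SimpleGraph.mulCayley X) r S {u} {w}
  disconnects_cosets : ∃ g₁ g₂ : G, RDisconnects (SimpleGraph.mulCayley X) r S
    ((fun h => g₁ * h) '' (H : Set G)) ((fun h => g₂ * h) '' (H : Set G))

/-- `G` is Hucha with respect to the family `𝓗` of subgroups: `G` is left-orderable and, for some
finite generating set `X`, for every positive cone `P`, every `H ∈ 𝓗` and every `r > 0` there is a
negative swamp of width `r` for `H` in the Cayley graph of `G` with respect to `X`. -/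
def IsHucha (G : Type*) [Group G] (𝓗 : Set (Subgroup G)) : Prop :=
  IsLeftOrderable G ∧ ∃ X : Set G, X.Finite ∧ Subgroup.closure X = ⊤ ∧
    ∀ P : Set G, IsPositiveCone P → ∀ H ∈ 𝓗, ∀ r : ℕ, 0 < r →
      ∃ S : Set G, IsNegativeSwamp X P H r S

/-! ### Group actions on trees -/

/-- `G` acts on the tree `T` (with vertex set `V`) by graph automorphisms without inversions. -/
structure IsTreeAction (G : Type*) [Group G] {V : Type*} [MulAction G V]
    (T : SimpleGraph V) : Prop where
  isTree : T.IsTree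
  smul_adj : ∀ (g : G) (u w : V), T.Adj u w → T.Adj (g • u) (g • w)
  no_inversion : ∀ (g : G) (u w : V), T.Adj u w → ¬ (g • u = w ∧ g • w = u)

/-- The stabilizer of an (unoriented) edge. -/
def edgeStabilizer (G : Type*) [Group G] {V : Type*} [MulAction G V] (e : Sym2 V) :
    Subgroup G where
  carrier := {g | e.map (fun x => g • x) = e}
  one_mem' := by
    induction e with
    | _ a b => simp
  mul_mem' := by
    intro g h hg hh
    have key : e.map (fun x => (g * h) • x) = (e.map (fun x => h • x)).map (fun x => g • x) := by
      rw [Sym2.map_map]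
      congr 1
      funext x
      exact mul_smul g h x
    simp only [Set.mem_ofPred_eq] at hg hh ⊢
    rw [key, hh, hg]
  inv_mem' := by
    intro g hg
    have key : (e.map (fun x => g • x)).map (fun x => g⁻¹ • x) = e := by
      induction e with
      | _ a b => simp
    simp only [Set.mem_ofPred_eq] at hg ⊢
    rw [hg] at key
    exact key

/-- The action is co-finite: there are finitely many orbits of vertices and of edges. -/
def IsCofiniteAction (G : Type*) [Group G] {V : Type*} [MulAction G V]
    (T : SimpleGraph V) : Prop :=
  (∃ F : Set V, F.Finite ∧ ∀ w : V, ∃ g : G, g • w ∈ F) ∧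
  (∃ F : Set (Sym2 V), F.Finite ∧ ∀ e ∈ T.edgeSet, ∃ g : G, e.map (fun x => g • x) ∈ F)

/-- The action is minimal: the only `G`-invariant (non-empty) subtree is the whole tree. Subtrees
of a tree are given by the vertex sets that induce a connected subgraph. -/
def IsMinimalAction (G : Type*) [Group G] {V : Type*} [MulAction G V]
    (T : SimpleGraph V) : Prop :=
  ∀ S : Set V, (T.induce S).Connected → (∀ g : G, ∀ w ∈ S, g • w ∈ S) → S = Set.univ

/-- A ray of the tree `T`: a semi-infinite path without repetitions. -/
structure IsRay {V : Type*} (T : SimpleGraph V) (p : ℕ → V) : Prop where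
  adj : ∀ n : ℕ, T.Adj (p n) (p (n + 1))
  injective : Function.Injective p

/-- Two rays of a tree define the same end if their intersection is infinite. -/
def SameEnd {V : Type*} (p q : ℕ → V) : Prop :=
  (Set.range p ∩ Set.range q).Infinite

/-- `G` fixes the end of some ray of `T`. -/
def FixesEnd (G : Type*) [Group G] {V : Type*} [MulAction G V] (T : SimpleGraph V) : Prop :=
  ∃ p : ℕ → V, IsRay T p ∧ ∀ g : G, SameEnd (fun n => g • p n) p

/-- The orbit of `v` accumulates at the end of the ray `p` of the tree `T`: for every `n` some
point of the orbit is joined to `p 0` by a geodesic that passes through `p n`. -/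
def OrbitMeetsEnd (G : Type*) [Group G] {V : Type*} [MulAction G V] (T : SimpleGraph V)
    (v : V) (p : ℕ → V) : Prop :=
  ∀ n : ℕ, ∃ g : G, T.dist (p 0) (g • v) = n + T.dist (p n) (g • v)

/-- The action is of general type: `G` fixes neither a vertex nor an end of `T`, and the orbit of
some vertex meets at least three different ends of `T`. -/
structure IsGeneralTypeAction (G : Type*) [Group G] {V : Type*} [MulAction G V]
    (T : SimpleGraph V) : Prop where
  no_fixed_vertex : ¬ ∃ w : V, ∀ g : G, g • w = w
  no_fixed_end : ¬ FixesEnd G T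
  three_ends : ∃ (v : V) (p₁ p₂ p₃ : ℕ → V),
    (IsRay T p₁ ∧ IsRay T p₂ ∧ IsRay T p₃) ∧
    (¬ SameEnd p₁ p₂ ∧ ¬ SameEnd p₁ p₃ ∧ ¬ SameEnd p₂ p₃) ∧
    OrbitMeetsEnd G T v p₁ ∧ OrbitMeetsEnd G T v p₂ ∧ OrbitMeetsEnd G T v p₃

/-- The subgroup `K` acts elliptically: it fixes a vertex. -/
def ActsElliptically {G : Type*} [Group G] (V : Type*) [MulAction G V] (K : Subgroup G) : Prop :=
  ∃ w : V, ∀ k ∈ K, k • w = w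

/-! The swamp is all of `P⁻¹`. The core is `exists_separated_halfTrees`: for each finite step set
`E` there are two half-trees such that every path with steps in `E`, from an element moving `v` into
the first to one moving `v` into the second, meets `P⁻¹`.

Follow `g • v` along a path that avoids `P⁻¹`, after left translation by a large `M`. Whenever a
step crosses `v`, the current `g` lies within a fixed finite set of an element of `G_v`, its marker
(`exists_markers`); the choice of `M` puts all markers in the conjugate cone `Q = M P M⁻¹`. While
the path stays in one branch at `v`, its entry and exit markers lie in one left coset of an edge
group, and the Prieto hypothesis joins them inside `Q` by bounded steps. So the path leaves as its
trace a chain in `Q ∩ G_v` with steps in a finite set. The Hucha property of `G_v` forbids such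
chains between some cosets `g₁H` and `g₂H`, so the corresponding branches, moved back by `M⁻¹`, are
separated.

It remains to see that half-trees are large. Without a fixed end, minimality lets any half-tree
absorb a translate of its complement (`exists_flip`). Hence it contains `u • v` for a positive `u`,
and a translate of any proper convex set. Elliptic subgroups preserve a point, and infinite cyclic
ones acting without fixed points preserve an axis, so a coset of each fits into every half-tree. -/

/-! ### Metric geometry of trees -/

/-- The half-tree of the vertices that are closer to `b` than to `a`. -/
def halfTree {V : Type*} (T : SimpleGraph V) (a b : V) : Set V :=
  {x | T.dist x b < T.dist x a}

/-- `y` lies on a geodesic from `x` to `z`. -/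
def IsBetween {V : Type*} (T : SimpleGraph V) (x y z : V) : Prop :=
  T.dist x z = T.dist x y + T.dist y z

/-- A set of vertices closed under geodesics. -/
def IsGeodesicallyConvex {V : Type*} (T : SimpleGraph V) (A : Set V) : Prop :=
  ∀ x ∈ A, ∀ z ∈ A, ∀ y, IsBetween T x y z → y ∈ A

section Tree

variable {V : Type*} {T : SimpleGraph V}

theorem mem_halfTree {a b x : V} : x ∈ halfTree T a b ↔ T.dist x b < T.dist x a := Iff.rfl

theorem IsBetween.symm {x y z : V} (h : IsBetween T x y z) : IsBetween T z y x := by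
  unfold IsBetween at *
  rw [T.dist_comm (u := z) (v := x), T.dist_comm (u := z) (v := y), T.dist_comm (u := y) (v := x)]
  omega

theorem isBetween_left (x z : V) : IsBetween T x x z := by simp [IsBetween]

theorem isBetween_right (x z : V) : IsBetween T x z z := by simp [IsBetween]

theorem SimpleGraph.Connected.exists_adj_dist (hT : T.Connected) {x y : V} (h : x ≠ y) :
    ∃ n, T.Adj x n ∧ T.dist x y = T.dist n y + 1 := by
  obtain ⟨p, hp⟩ := hT.exists_walk_length_eq_dist x y
  cases p with
  | nil => exact absurd rfl h
  | @cons _ n _ hadj q =>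
    refine ⟨n, hadj, ?_⟩
    have h1 := T.dist_le q
    have h2 := hT.dist_triangle (u := x) (v := n) (w := y)
    have h3 := T.dist_eq_one_iff_adj.2 hadj
    simp only [SimpleGraph.Walk.length_cons] at hp
    omega

theorem mem_halfTree_of_isBetween {x y z : V} (h : T.Adj x y)
    (hb : IsBetween T x y z) : z ∈ halfTree T x y := by
  unfold IsBetween at hb
  rw [mem_halfTree, T.dist_comm (u := z), T.dist_comm (u := z)]
  have := T.dist_eq_one_iff_adj.2 h
  omega

theorem right_mem_halfTree {a b : V} (h : T.Adj a b) : b ∈ halfTree T a b := by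
  rw [mem_halfTree, T.dist_self, T.dist_comm, T.dist_eq_one_iff_adj.2 h]
  omega

theorem left_notMem_halfTree (a b : V) : a ∉ halfTree T a b := by
  rw [mem_halfTree, T.dist_self]
  omega

namespace SimpleGraph.IsTree

theorem dist_adj (hT : T.IsTree) {a b : V} (h : T.Adj a b) (x : V) :
    T.dist x b = T.dist x a + 1 ∨ T.dist x a = T.dist x b + 1 := by
  have h1 := hT.dist_ne_of_adj x h
  have h2 := hT.1.dist_triangle (u := x) (v := a) (w := b)
  have h3 := hT.1.dist_triangle (u := x) (v := b) (w := a)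
  have h4 := T.dist_eq_one_iff_adj.2 h
  have h5 := T.dist_eq_one_iff_adj.2 h.symm
  omega

theorem dist_of_mem_halfTree (hT : T.IsTree) {a b x : V} (h : T.Adj a b)
    (hx : x ∈ halfTree T a b) : T.dist x a = T.dist x b + 1 := by
  rw [mem_halfTree] at hx
  have := hT.dist_adj h x
  omega

theorem notMem_halfTree (hT : T.IsTree) {a b x : V} (h : T.Adj a b) :
    x ∉ halfTree T a b ↔ x ∈ halfTree T b a := by
  rw [mem_halfTree, mem_halfTree]
  have := hT.dist_adj h x
  omega

/-- Each of `n`, `m` is the penultimate vertex of a shortest walk from `x` to `v`, and paths in a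
tree are unique. This is the main tool for identifying directions at a vertex. -/
theorem eq_of_adj_of_mem_halfTree (hT : T.IsTree) {v n m x : V} (hn : T.Adj v n)
    (hm : T.Adj v m) (hxn : x ∈ halfTree T v n) (hxm : x ∈ halfTree T v m) : n = m := by
  have h1 := hT.dist_of_mem_halfTree hn hxn
  have h2 := hT.dist_of_mem_halfTree hm hxm
  obtain ⟨p, hp⟩ := hT.1.exists_walk_length_eq_dist x n
  obtain ⟨q, hq⟩ := hT.1.exists_walk_length_eq_dist x m
  have hp' : (p.concat hn.symm).IsPath :=
    SimpleGraph.Walk.isPath_of_length_eq_dist _ (by simp; omega)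
  have hq' : (q.concat hm.symm).IsPath :=
    SimpleGraph.Walk.isPath_of_length_eq_dist _ (by simp; omega)
  have := (hT.existsUnique_path x v).unique hp' hq'
  exact (SimpleGraph.Walk.concat_inj this).1

/-- Induction moves the edge one step towards `y`. The vertex `x` stays behind it, since otherwise
the new edge would lead back to `a`, with `y` on the wrong side. -/
theorem dist_of_mem_halfTrees (hT : T.IsTree) {a b x y : V} (h : T.Adj a b)
    (hx : x ∈ halfTree T b a) (hy : y ∈ halfTree T a b) :
    T.dist x y = T.dist x a + 1 + T.dist b y := by
  induction hk : T.dist b y generalizing a b with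
  | zero =>
    rw [hT.1.dist_eq_zero_iff] at hk
    subst hk
    exact hT.dist_of_mem_halfTree h.symm hx
  | succ k ih =>
    have hby : b ≠ y := by
      rintro rfl
      simp at hk
    obtain ⟨c, hc, hd⟩ := hT.1.exists_adj_dist hby
    have hyc : y ∈ halfTree T b c := by
      rw [mem_halfTree, T.dist_comm (u := y), T.dist_comm (u := y)]
      omega
    have hxc : x ∈ halfTree T c b := by
      rw [← hT.notMem_halfTree hc]
      intro hxc
      have := hT.eq_of_adj_of_mem_halfTree h.symm hc hx hxc
      subst this
      exact (hT.notMem_halfTree h).2 hyc hy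
    have := ih hc hxc hyc (by omega)
    have := hT.dist_of_mem_halfTree h.symm hx
    omega

theorem isBetween_of_mem_halfTrees (hT : T.IsTree) {a b x y : V} (h : T.Adj a b)
    (hx : x ∈ halfTree T b a) (hy : y ∈ halfTree T a b) : IsBetween T x a y := by
  have h1 := hT.dist_of_mem_halfTrees h hx hy
  have h2 := hT.dist_of_mem_halfTree h hy
  unfold IsBetween
  rw [T.dist_comm (u := y), T.dist_comm (u := y)] at h2
  omega

theorem exists_halfTree (hT : T.IsTree) {v x : V} (h : v ≠ x) :
    ∃ n, T.Adj v n ∧ x ∈ halfTree T v n := by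
  obtain ⟨n, hn, hd⟩ := hT.1.exists_adj_dist h
  refine ⟨n, hn, ?_⟩
  rw [mem_halfTree, T.dist_comm (u := x), T.dist_comm (u := x)]
  omega

theorem not_isBetween_of_mem_halfTree (hT : T.IsTree) {v n x y : V} (h : T.Adj v n)
    (hx : x ∈ halfTree T v n) (hy : y ∈ halfTree T v n) : ¬ IsBetween T x v y := by
  unfold IsBetween
  have h1 := hT.dist_of_mem_halfTree h hx
  have h2 := hT.dist_of_mem_halfTree h hy
  have h3 := hT.1.dist_triangle (u := x) (v := n) (w := y)
  rw [T.dist_comm (u := y), T.dist_comm (u := y)] at h2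
  omega

theorem mem_halfTree_of_not_isBetween (hT : T.IsTree) {v n x y : V} (h : T.Adj v n)
    (hx : x ∈ halfTree T v n) (hy : ¬ IsBetween T x v y) : y ∈ halfTree T v n := by
  by_contra hc
  exact hy (hT.isBetween_of_mem_halfTrees h ((hT.notMem_halfTree h).1 hc) hx).symm

/-- A vertex separating `x` from `z` separates every vertex from one of them. -/
theorem isBetween_or_isBetween (hT : T.IsTree) {x y z : V} (h : IsBetween T x y z) (w : V) :
    IsBetween T w y x ∨ IsBetween T w y z := by
  by_contra! hc
  by_cases hyw : y = w
  · subst hyw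
    exact hc.1 (isBetween_left _ _)
  obtain ⟨n, hn, hw⟩ := hT.exists_halfTree hyw
  exact hT.not_isBetween_of_mem_halfTree hn (hT.mem_halfTree_of_not_isBetween hn hw hc.1)
    (hT.mem_halfTree_of_not_isBetween hn hw hc.2) h

theorem eq_of_isBetween (hT : T.IsTree) {x y y' z : V} (h : IsBetween T x y z)
    (h' : IsBetween T x y' z) (hd : T.dist x y = T.dist x y') : y = y' := by
  rw [← hT.1.dist_eq_zero_iff]
  have := hT.isBetween_or_isBetween h y'
  unfold IsBetween at *
  rw [T.dist_comm (u := y') (v := x), T.dist_comm (u := y') (v := y),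
    T.dist_comm (u := y) (v := x)] at this
  omega

theorem finite_isBetween (hT : T.IsTree) (x z : V) : {y | IsBetween T x y z}.Finite := by
  apply Set.Finite.of_injOn (f := fun y => T.dist x y) (t := Set.Iic (T.dist x z))
  · intro y hy
    have hy : IsBetween T x y z := hy
    unfold IsBetween at hy
    simp only [Set.mem_Iic]
    omega
  · intro y hy y' hy' hd
    exact hT.eq_of_isBetween hy hy' hd
  · exact Set.finite_Iic _

theorem isGeodesicallyConvex_halfTree (hT : T.IsTree) {a b : V} (h : T.Adj a b) :
    IsGeodesicallyConvex T (halfTree T a b) := by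
  intro x hx z hz y hy
  by_contra hc
  rw [hT.notMem_halfTree h] at hc
  have h1 := hT.dist_of_mem_halfTrees h hc hx
  have h2 := hT.dist_of_mem_halfTrees h hc hz
  have h3 := hT.1.dist_triangle (u := x) (v := b) (w := z)
  unfold IsBetween at hy
  rw [T.dist_comm (u := x) (v := y)] at hy
  rw [T.dist_comm (u := x) (v := b)] at h3
  omega

/-- A convex set that misses the endpoint `a` of an edge lies on one side of the edge. -/
theorem subset_halfTree_or (hT : T.IsTree) {a b : V} (h : T.Adj a b) {A : Set V}
    (hA : IsGeodesicallyConvex T A) (ha : a ∉ A) :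
    A ⊆ halfTree T a b ∨ A ⊆ halfTree T b a := by
  by_contra! hc
  obtain ⟨⟨x, hx, hx'⟩, ⟨y, hy, hy'⟩⟩ := And.intro (Set.not_subset.1 hc.1) (Set.not_subset.1 hc.2)
  rw [hT.notMem_halfTree h] at hx'
  rw [hT.notMem_halfTree h.symm] at hy'
  exact ha (hA x hx y hy a (hT.isBetween_of_mem_halfTrees h hx' hy'))

theorem exists_mem_halfTree_of_convex (hT : T.IsTree) {A : Set V}
    (hA : IsGeodesicallyConvex T A) (hne : A.Nonempty) {x : V} (hx : x ∉ A) :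
    ∃ n, T.Adj x n ∧ A ⊆ halfTree T x n := by
  obtain ⟨c, hc⟩ := hne
  obtain ⟨n, hn, hcn⟩ := hT.exists_halfTree (v := x) (x := c) (fun h => hx (h ▸ hc))
  refine ⟨n, hn, (hT.subset_halfTree_or hn hA hx).resolve_right fun h => ?_⟩
  exact (hT.notMem_halfTree hn.symm).2 hcn (h hc)

/-- A sequence without backtracking is a geodesic. -/
theorem dist_of_no_backtrack (hT : T.IsTree) {p : ℕ → V} (hadj : ∀ n, T.Adj (p n) (p (n + 1)))
    (hnb : ∀ n, p (n + 2) ≠ p n) (m n : ℕ) : T.dist (p m) (p (m + n)) = n := by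
  suffices ∀ n, T.dist (p m) (p (m + n)) = n ∧ T.dist (p m) (p (m + (n + 1))) = n + 1 from
    (this n).1
  intro n
  induction n with
  | zero => simpa using T.dist_eq_one_iff_adj.2 (hadj m)
  | succ n ih =>
    refine ⟨ih.2, ?_⟩
    have h1 := hT.dist_adj (hadj (m + (n + 1))) (p m)
    refine (h1.resolve_right fun h2 => ?_).trans (by rw [ih.2])
    refine hnb (m + n) (hT.eq_of_adj_of_mem_halfTree (hadj (m + (n + 1)))
      (hadj (m + n)).symm (x := p m) ?_ ?_)
    · rw [mem_halfTree]
      show T.dist (p m) (p (m + (n + 1) + 1)) < T.dist (p m) (p (m + (n + 1)))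
      omega
    · rw [mem_halfTree]
      show T.dist (p m) (p (m + n)) < T.dist (p m) (p (m + (n + 1)))
      omega

theorem isRay_of_no_backtrack (hT : T.IsTree) {p : ℕ → V} (hadj : ∀ n, T.Adj (p n) (p (n + 1)))
    (hnb : ∀ n, p (n + 2) ≠ p n) : IsRay T p := by
  refine ⟨hadj, ?_⟩
  have key : ∀ m n, p m = p (m + n) → n = 0 := by
    intro m n h
    have := hT.dist_of_no_backtrack hadj hnb m n
    rw [← h, T.dist_self] at this
    exact this.symm
  intro m n h
  rcases le_total m n with hmn | hmn
  · have := key m (n - m) (by rw [h]; congr 1; omega)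
    omega
  · have := key n (m - n) (by rw [← h]; congr 1; omega)
    omega

theorem reachable_induce_of_isBetween (hT : T.IsTree) {S : Set V} {x z : V}
    (h : ∀ y, IsBetween T x y z → y ∈ S) :
    (T.induce S).Reachable ⟨x, h x (isBetween_left x z)⟩ ⟨z, h z (isBetween_right x z)⟩ := by
  induction hk : T.dist x z generalizing x with
  | zero =>
    rw [hT.1.dist_eq_zero_iff] at hk
    subst hk
    exact SimpleGraph.Reachable.refl _
  | succ k ih =>
    have hxz : x ≠ z := by
      rintro rfl
      simp at hk
    obtain ⟨n, hn, hd⟩ := hT.1.exists_adj_dist hxz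
    have key : ∀ y, IsBetween T n y z → y ∈ S := by
      intro y hy
      apply h
      unfold IsBetween at *
      have h1 := hT.1.dist_triangle (u := x) (v := y) (w := z)
      have h2 := hT.1.dist_triangle (u := x) (v := n) (w := y)
      have h3 := T.dist_eq_one_iff_adj.2 hn
      omega
    have hadj : (T.induce S).Adj ⟨x, h x (isBetween_left x z)⟩
        ⟨n, key n (isBetween_left n z)⟩ := by simpa using hn
    exact hadj.reachable.trans (ih key (by omega))

end SimpleGraph.IsTree

end Tree

/-! ### Minimal actions on trees -/

section TreeAction

variable {G V : Type*} [Group G] [MulAction G V] {T : SimpleGraph V}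

namespace IsTreeAction

theorem adj_smul_iff (hT : IsTreeAction G T) (g : G) {x y : V} :
    T.Adj (g • x) (g • y) ↔ T.Adj x y := by
  refine ⟨fun h => ?_, hT.smul_adj g x y⟩
  simpa using hT.smul_adj g⁻¹ _ _ h

theorem dist_smul (hT : IsTreeAction G T) (g : G) (x y : V) :
    T.dist (g • x) (g • y) = T.dist x y := by
  have key : ∀ (g : G) (x y : V), T.dist (g • x) (g • y) ≤ T.dist x y := by
    intro g x y
    obtain ⟨p, hp⟩ := hT.isTree.1.exists_walk_length_eq_dist x y
    let f : T →g T := ⟨fun x => g • x, fun h => hT.smul_adj g _ _ h⟩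
    have := T.dist_le (p.map f)
    rw [SimpleGraph.Walk.length_map, hp] at this
    exact this
  refine le_antisymm (key g x y) ?_
  simpa using key g⁻¹ (g • x) (g • y)

theorem dist_smul_left (hT : IsTreeAction G T) (g : G) (x y : V) :
    T.dist (g • x) y = T.dist x (g⁻¹ • y) := by
  rw [← hT.dist_smul g x, smul_inv_smul]

theorem smul_mem_halfTree (hT : IsTreeAction G T) (g : G) {a b x : V} :
    g • x ∈ halfTree T (g • a) (g • b) ↔ x ∈ halfTree T a b := by
  rw [mem_halfTree, mem_halfTree, hT.dist_smul, hT.dist_smul]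

theorem isBetween_smul (hT : IsTreeAction G T) (g : G) {x y z : V} :
    IsBetween T (g • x) (g • y) (g • z) ↔ IsBetween T x y z := by
  unfold IsBetween
  rw [hT.dist_smul, hT.dist_smul, hT.dist_smul]

/-- The union of the geodesics between points of the orbit of `w` is an invariant subtree. -/
theorem exists_isBetween_orbit (hT : IsTreeAction G T) (hmin : IsMinimalAction G T) (w y : V) :
    ∃ g h : G, IsBetween T (g • w) y (h • w) := by
  let S : Set V := {y | ∃ g h : G, IsBetween T (g • w) y (h • w)}
  have hS : S = Set.univ := by
    apply hmin
    · have horb : ∀ g : G, g • w ∈ S := fun g => ⟨g, g, isBetween_left _ _⟩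
      have hbase : ∀ x : S, (T.induce S).Reachable ⟨(1 : G) • w, horb 1⟩ x := by
        rintro ⟨x, g, h, hx⟩
        have h1 := hT.isTree.reachable_induce_of_isBetween (S := S) (x := (1 : G) • w)
          (z := g • w) fun y hy => ⟨1, g, hy⟩
        have h2 := hT.isTree.reachable_induce_of_isBetween (S := S) (x := g • w)
          (z := x) fun y hy => ⟨g, h, by
            unfold IsBetween at *
            have h1 := hT.isTree.1.dist_triangle (u := g • w) (v := y) (w := h • w)
            have h2 := hT.isTree.1.dist_triangle (u := y) (v := x) (w := h • w)
            omega⟩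
        exact h1.trans h2
      have : Nonempty S := ⟨⟨_, horb 1⟩⟩
      exact ⟨fun x y => (hbase x).symm.trans (hbase y)⟩
    · rintro k x ⟨g, h, hx⟩
      refine ⟨k * g, k * h, ?_⟩
      rw [mul_smul, mul_smul]
      exact (hT.isBetween_smul k).2 hx
  have : y ∈ S := hS ▸ Set.mem_univ y
  exact this

theorem eq_univ_of_orbit_subset (hT : IsTreeAction G T) (hmin : IsMinimalAction G T) {A : Set V}
    (hA : IsGeodesicallyConvex T A) {w : V} (hw : ∀ g : G, g • w ∈ A) : A = Set.univ := by
  refine Set.eq_univ_of_forall fun y => ?_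
  obtain ⟨g, h, hy⟩ := hT.exists_isBetween_orbit hmin w y
  exact hA _ (hw g) _ (hw h) y hy

/-- A minimal action has no leaves. -/
theorem exists_adj_ne (hT : IsTreeAction G T) (hmin : IsMinimalAction G T) {a b : V}
    (h : T.Adj a b) : ∃ c, T.Adj b c ∧ c ≠ a := by
  by_contra! hc
  -- If `g • a = b`, then `g • b` is a neighbour of the leaf `b`, hence equals `a`: an inversion.
  have key : ∀ g : G, g • a ≠ b := by
    intro g hg
    have h1 : T.Adj b (g • b) := by
      rw [← hg, hT.adj_smul_iff, hg]
      exact h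
    exact hT.no_inversion g a b h ⟨hg, hc _ h1⟩
  have hside : ∀ g : G, g • a ∈ halfTree T b a := by
    intro g
    obtain ⟨n, hn, hgn⟩ := hT.isTree.exists_halfTree (key g).symm
    rwa [hc n hn] at hgn
  obtain ⟨g, k, hgk⟩ := hT.exists_isBetween_orbit hmin a b
  exact hT.isTree.not_isBetween_of_mem_halfTree h.symm (hside g) (hside k) hgk

/-- The depth `n` provides room to absorb a bounded displacement without leaving the original
half-tree. -/
theorem exists_deep_halfTree (hT : IsTreeAction G T) (hmin : IsMinimalAction G T) {a b : V}
    (h : T.Adj a b) (n : ℕ) :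
    ∃ a' b' : V, T.Adj a' b' ∧ halfTree T a' b' ⊆ halfTree T a b ∧ T.dist a a' = n := by
  induction n with
  | zero => exact ⟨a, b, h, subset_rfl, by simp⟩
  | succ n ih =>
    obtain ⟨a', b', hadj, hsub, hd⟩ := ih
    obtain ⟨c, hc, hca⟩ := hT.exists_adj_ne hmin hadj
    have ha' : a' ∈ halfTree T c b' := by
      rw [← hT.isTree.notMem_halfTree hc]
      intro hmem
      exact hca (hT.isTree.eq_of_adj_of_mem_halfTree hc hadj.symm hmem
        (right_mem_halfTree hadj.symm))
    have ha : a ∈ halfTree T b' a' := by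
      rw [← hT.isTree.notMem_halfTree hadj]
      exact fun hmem => left_notMem_halfTree a b (hsub hmem)
    refine ⟨b', c, hc, fun x hx => hsub ?_, ?_⟩
    · have h1 := hT.isTree.isBetween_of_mem_halfTrees hc ha' hx
      exact mem_halfTree_of_isBetween hadj h1
    · rw [hT.isTree.dist_of_mem_halfTree hadj.symm ha, hd]

end IsTreeAction

/-- Pairwise intersecting translates of a convex set without common points determine a fixed
end. -/
theorem IsTreeAction.fixesEnd_of_translates (hT : IsTreeAction G T) {C : Set V}
    (hC : IsGeodesicallyConvex T C)
    (hpair : ∀ h : G, ∃ c ∈ C, h • c ∈ C) (hempty : ∀ x : V, ∃ h : G, h • x ∉ C) :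
    FixesEnd G T := by
  have hCne : C.Nonempty := let ⟨c, hc, _⟩ := hpair 1; ⟨c, hc⟩
  -- All translates of `C` missing `x` lie in one direction from `x`, because they meet pairwise.
  -- Following these directions yields an equivariant flow `φ`, whose orbits are rays to the fixed
  -- end.
  have hdir : ∀ x : V, ∃ n, T.Adj x n ∧
      ∀ h : G, h • x ∉ C → ∀ c, h • c ∈ C → c ∈ halfTree T x n := by
    intro x
    have hconv : ∀ h : G, IsGeodesicallyConvex T {c | h • c ∈ C} := fun h a ha b hb y hy =>
      hC _ ha _ hb _ ((hT.isBetween_smul h).2 hy)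
    have hne : ∀ h : G, {c | h • c ∈ C}.Nonempty := fun h => by
      obtain ⟨c, hc⟩ := hCne
      exact ⟨h⁻¹ • c, by simpa using hc⟩
    obtain ⟨h₀, hh₀⟩ := hempty x
    obtain ⟨n, hn, hsub⟩ := hT.isTree.exists_mem_halfTree_of_convex (hconv h₀) (hne h₀) hh₀
    refine ⟨n, hn, fun h hh c hc => ?_⟩
    obtain ⟨m, hm, hsub'⟩ := hT.isTree.exists_mem_halfTree_of_convex (hconv h) (hne h) hh
    obtain ⟨d, hd, hd'⟩ := hpair (h * h₀⁻¹)
    have e1 : h₀⁻¹ • d ∈ halfTree T x n := hsub (by simpa using hd)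
    have e2 : h₀⁻¹ • d ∈ halfTree T x m := hsub' (by simpa [mul_smul] using hd')
    rw [hT.isTree.eq_of_adj_of_mem_halfTree hn hm e1 e2]
    exact hsub' hc
  choose φ hadj hφ using hdir
  have hmem : ∀ h : G, ∃ c, h • c ∈ C := fun h => by
    obtain ⟨c, hc⟩ := hCne
    exact ⟨h⁻¹ • c, by simpa using hc⟩
  have hequiv : ∀ (g : G) (x : V), φ (g • x) = g • φ x := by
    intro g x
    obtain ⟨h, hh⟩ := hempty x
    obtain ⟨c, hc⟩ := hmem h
    refine hT.isTree.eq_of_adj_of_mem_halfTree (x := g • c) (hadj _)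
      ((hT.adj_smul_iff g).2 (hadj x)) ?_ ((hT.smul_mem_halfTree g).2 (hφ x h hh c hc))
    exact hφ (g • x) (h * g⁻¹) (by simpa [mul_smul] using hh) _ (by simpa [mul_smul] using hc)
  -- Backtracking would put two intersecting translates on opposite sides of one edge.
  have hnb : ∀ x, φ (φ x) ≠ x := by
    intro x hx
    obtain ⟨h, hh⟩ := hempty x
    obtain ⟨k, hk⟩ := hempty (φ x)
    obtain ⟨d, hd, hd'⟩ := hpair (h * k⁻¹)
    have e1 := hφ x h hh (k⁻¹ • d) (by simpa [mul_smul] using hd')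
    have e2 := hφ (φ x) k hk (k⁻¹ • d) (by simpa using hd)
    rw [hx] at e2
    exact (hT.isTree.notMem_halfTree (hadj x)).2 e2 e1
  have hstep : ∀ x y, T.Adj x y → φ x = y ∨ φ y = x := by
    intro x y hxy
    obtain ⟨h, hh⟩ := hempty x
    by_cases hy : h • y ∈ C
    · left
      exact hT.isTree.eq_of_adj_of_mem_halfTree (hadj x) hxy (hφ x h hh y hy)
        (right_mem_halfTree hxy)
    · obtain ⟨c, hc⟩ := hmem h
      by_cases hcy : c ∈ halfTree T x y
      · exact Or.inl (hT.isTree.eq_of_adj_of_mem_halfTree (hadj x) hxy (hφ x h hh c hc) hcy)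
      · rw [hT.isTree.notMem_halfTree hxy] at hcy
        exact Or.inr (hT.isTree.eq_of_adj_of_mem_halfTree (hadj y) hxy.symm (hφ y h hy c hc) hcy)
  -- Of two adjacent vertices one flows to the other, so flow lines merge along any walk.
  have hmerge : ∀ x y, ∃ m n, φ^[m] x = φ^[n] y := by
    intro x y
    obtain ⟨p⟩ := hT.isTree.1 x y
    induction p with
    | nil => exact ⟨0, 0, rfl⟩
    | @cons x y z hxy p ih =>
      obtain ⟨m, n, hmn⟩ := ih
      rcases hstep x y hxy with h | h
      · exact ⟨m + 1, n, by rw [Function.iterate_succ_apply, h, hmn]⟩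
      · refine ⟨m, n + 1, ?_⟩
        rw [Function.iterate_succ_apply', ← hmn, ← Function.iterate_succ_apply' φ,
          Function.iterate_succ_apply, h]
  obtain ⟨x₀⟩ := hT.isTree.1.nonempty
  have hray : IsRay T fun n => φ^[n] x₀ := by
    apply hT.isTree.isRay_of_no_backtrack
    · intro n
      rw [Function.iterate_succ_apply']
      exact hadj _
    · intro n
      rw [Function.iterate_succ_apply', Function.iterate_succ_apply']
      exact hnb _
  refine ⟨_, hray, fun g => ?_⟩
  obtain ⟨m, n, hmn⟩ := hmerge (g • x₀) x₀
  have hit : ∀ k, g • φ^[k] x₀ = φ^[k] (g • x₀) := by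
    intro k
    induction k with
    | zero => rfl
    | succ k ih => rw [Function.iterate_succ_apply', Function.iterate_succ_apply', ← hequiv, ih]
  refine (Set.infinite_range_of_injective (f := fun i : ℕ => φ^[i + n] x₀)
    fun i j hij => ?_).mono ?_
  · have := hray.injective hij
    omega
  · rintro _ ⟨i, rfl⟩
    refine ⟨⟨i + m, ?_⟩, ⟨i + n, rfl⟩⟩
    simp only [hit]
    rw [Function.iterate_add_apply, hmn, ← Function.iterate_add_apply]

/-- Some translate of the complement of a half-tree lies in the half-tree. -/
theorem IsTreeAction.exists_flip (hT : IsTreeAction G T) (hmin : IsMinimalAction G T)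
    (hend : ¬ FixesEnd G T) {a b : V} (h : T.Adj a b) :
    ∃ g : G, ∀ x ∈ halfTree T b a, g • x ∈ halfTree T a b := by
  -- If no element flips, the translates of the opposite half-tree meet pairwise. A common point
  -- would have its whole orbit in that half-tree, against minimality; so an end would be fixed.
  by_contra! hc
  have hconv := hT.isTree.isGeodesicallyConvex_halfTree h.symm
  refine hend (hT.fixesEnd_of_translates hconv (fun g => ?_) fun x => ?_)
  · obtain ⟨x, hx, hgx⟩ := hc g
    exact ⟨x, hx, (hT.isTree.notMem_halfTree h).1 hgx⟩
  · by_contra! hx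
    have := hT.eq_univ_of_orbit_subset hmin hconv hx
    exact left_notMem_halfTree b a (this ▸ Set.mem_univ b)

/-- Every proper convex set has a translate in any given half-tree. -/
theorem IsTreeAction.exists_smul_subset_halfTree (hT : IsTreeAction G T)
    (hmin : IsMinimalAction G T) (hend : ¬ FixesEnd G T) {a b : V} (h : T.Adj a b) {A : Set V}
    (hA : IsGeodesicallyConvex T A) (hne : A ≠ Set.univ) :
    ∃ g : G, ∀ x ∈ A, g • x ∈ halfTree T a b := by
  have : ∃ g : G, g • a ∉ A := by
    by_contra! hc
    exact hne (hT.eq_univ_of_orbit_subset hmin hA hc)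
  obtain ⟨g, hg⟩ := this
  rcases hT.isTree.subset_halfTree_or ((hT.adj_smul_iff g).2 h) hA hg with hs | hs
  · refine ⟨g⁻¹, fun x hx => ?_⟩
    rw [← hT.smul_mem_halfTree g, smul_inv_smul]
    exact hs hx
  · obtain ⟨k, hk⟩ := hT.exists_flip hmin hend h
    refine ⟨k * g⁻¹, fun x hx => ?_⟩
    rw [mul_smul]
    apply hk
    rw [← hT.smul_mem_halfTree g, smul_inv_smul]
    exact hs hx

end TreeAction

/-! ### Rays and branching vertices -/

namespace SimpleGraph.IsTree

variable {V : Type*} {T : SimpleGraph V}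

/-- The distance to `x₀` cannot decrease forever along the ray, and once it increases it continues
to, since a turn would make the ray repeat a vertex. -/
theorem exists_ray_tail (hT : T.IsTree) {q : ℕ → V} (hq : IsRay T q) (x₀ : V) :
    ∃ a, T.Adj x₀ a ∧ ∃ N L, ∀ n, q (N + n) ∈ halfTree T x₀ a ∧
      T.dist x₀ (q (N + n)) = L + n := by
  have hstep := fun n => hT.dist_adj (hq.adj n) x₀
  have hmono : ∀ n, T.dist x₀ (q (n + 1)) = T.dist x₀ (q n) + 1 →
      T.dist x₀ (q (n + 2)) = T.dist x₀ (q (n + 1)) + 1 := by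
    intro n hn
    refine (hstep (n + 1)).resolve_right fun h => ?_
    have := hT.eq_of_adj_of_mem_halfTree (x := x₀) (hq.adj (n + 1)) (hq.adj n).symm
      (mem_halfTree.2 (by omega)) (mem_halfTree.2 (by omega))
    have := hq.injective this
    omega
  have hex : ∃ n, T.dist x₀ (q (n + 1)) = T.dist x₀ (q n) + 1 := by
    by_contra! hc
    have hdec : ∀ n, T.dist x₀ (q n) + n = T.dist x₀ (q 0) := by
      intro n
      induction n with
      | zero => rfl
      | succ n ih =>
        have := (hstep n).resolve_left (hc n)
        omega
    have := hdec (T.dist x₀ (q 0) + 1)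
    omega
  obtain ⟨M, hM⟩ := hex
  have hlev : ∀ n, T.dist x₀ (q (M + n)) = T.dist x₀ (q M) + n ∧
      T.dist x₀ (q (M + n + 1)) = T.dist x₀ (q (M + n)) + 1 := by
    intro n
    induction n with
    | zero => exact ⟨rfl, hM⟩
    | succ n ih => exact ⟨by rw [← add_assoc, ih.2, ih.1]; omega, hmono _ ih.2⟩
  have hne : x₀ ≠ q (M + 1) := by
    intro h
    have := (hlev 1).1
    rw [← h, T.dist_self] at this
    omega
  obtain ⟨a, ha, hqa⟩ := hT.exists_halfTree hne
  refine ⟨a, ha, M + 1, T.dist x₀ (q M) + 1, fun n => ⟨?_, ?_⟩⟩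
  · induction n with
    | zero => exact hqa
    | succ n ih =>
      by_contra hc
      rw [hT.notMem_halfTree ha] at hc
      have h1 := hT.dist_of_mem_halfTrees ha hc ih
      have h2 := T.dist_eq_one_iff_adj.2 (hq.adj (M + 1 + n)).symm
      have h3 := (hlev (1 + n + 1)).1
      rw [T.dist_comm] at h3
      have e : M + (1 + n + 1) = M + 1 + n + 1 := by omega
      have e' : M + 1 + (n + 1) = M + 1 + n + 1 := by omega
      rw [e] at h3
      rw [e'] at h1
      omega
  · have := (hlev (1 + n)).1
    rw [← add_assoc] at this
    omega

/-- Without branching a half-tree is a segment or a ray, so distance to its base is a coordinate. -/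
theorem eq_of_dist_eq_of_no_branching (hT : T.IsTree)
    (hnb : ∀ z y₁ y₂ y₃, T.Adj z y₁ → T.Adj z y₂ → T.Adj z y₃ → y₁ ≠ y₂ → y₁ ≠ y₃ → y₂ = y₃)
    {x₀ a : V} (ha : T.Adj x₀ a) {x y : V} (hx : x ∈ halfTree T x₀ a)
    (hy : y ∈ halfTree T x₀ a) (hd : T.dist x x₀ = T.dist y x₀) : x = y := by
  induction hn : T.dist x x₀ generalizing x y with
  | zero =>
    rw [mem_halfTree] at hx
    omega
  | succ n ih =>
    have hpred : ∀ {x}, x ∈ halfTree T x₀ a → T.dist x x₀ = n + 1 →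
        (n = 0 ∧ x = a) ∨ ∃ x', T.Adj x' x ∧ x' ∈ halfTree T x₀ a ∧ T.dist x' x₀ = n := by
      intro x hx hn
      have hxx : x ≠ x₀ := by
        rintro rfl
        simp at hn
      obtain ⟨x', hadj, hd⟩ := hT.1.exists_adj_dist hxx
      by_cases hx' : x' ∈ halfTree T x₀ a
      · exact Or.inr ⟨x', hadj.symm, hx', by omega⟩
      · rw [hT.notMem_halfTree ha] at hx'
        have h1 := hT.dist_of_mem_halfTrees ha hx' hx
        have h2 := T.dist_eq_one_iff_adj.2 hadj.symm
        refine Or.inl ⟨by omega, ?_⟩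
        rw [← hT.1.dist_eq_zero_iff, T.dist_comm]
        omega
    rcases hpred hx hn with ⟨h0, rfl⟩ | ⟨x', hadj, hx', hdx⟩
    · rcases hpred hy (by omega) with ⟨-, rfl⟩ | ⟨y', hadj', hy', hdy⟩
      · rfl
      · rw [mem_halfTree] at hy'
        omega
    · rcases hpred hy (by omega) with ⟨h0, rfl⟩ | ⟨y', hadj', hy', hdy⟩
      · rw [mem_halfTree] at hx'
        omega
      · obtain rfl := ih hx' hy' (by omega) hdx
        have hxx : x' ≠ x₀ := by
          rintro rfl
          exact left_notMem_halfTree _ _ hx'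
        obtain ⟨c, hc, hdc⟩ := hT.1.exists_adj_dist hxx
        refine hnb x' c x y hc hadj hadj' ?_ ?_ <;>
        · rintro rfl
          omega

theorem sameEnd_of_no_branching (hT : T.IsTree)
    (hnb : ∀ z y₁ y₂ y₃, T.Adj z y₁ → T.Adj z y₂ → T.Adj z y₃ → y₁ ≠ y₂ → y₁ ≠ y₃ → y₂ = y₃)
    {x₀ a : V} (ha : T.Adj x₀ a) {p q : ℕ → V} (hp : IsRay T p) {N L N' L' : ℕ}
    (hN : ∀ n, p (N + n) ∈ halfTree T x₀ a ∧ T.dist x₀ (p (N + n)) = L + n)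
    (hN' : ∀ n, q (N' + n) ∈ halfTree T x₀ a ∧ T.dist x₀ (q (N' + n)) = L' + n) :
    SameEnd p q := by
  -- Shifting `p` by `L'` and `q` by `L` equalizes the distances to `x₀`.
  refine (Set.infinite_range_of_injective (f := fun k : ℕ => p (N + (L' + k)))
    fun i j hij => ?_).mono ?_
  · have := hp.injective hij
    omega
  · rintro _ ⟨k, rfl⟩
    refine ⟨⟨_, rfl⟩, ⟨N' + (L + k), ?_⟩⟩
    refine hT.eq_of_dist_eq_of_no_branching hnb ha (hN' _).1 (hN _).1 ?_
    rw [T.dist_comm, (hN' _).2, T.dist_comm, (hN _).2]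
    omega

/-- A tree with at least three ends has a branching vertex. -/
theorem exists_branching (hT : T.IsTree) {p₁ p₂ p₃ : ℕ → V} (h₁ : IsRay T p₁) (h₂ : IsRay T p₂)
    (h₃ : IsRay T p₃) (h₁₂ : ¬ SameEnd p₁ p₂) (h₁₃ : ¬ SameEnd p₁ p₃) (h₂₃ : ¬ SameEnd p₂ p₃) :
    ∃ z y₁ y₂ y₃, T.Adj z y₁ ∧ T.Adj z y₂ ∧ T.Adj z y₃ ∧ y₁ ≠ y₂ ∧ y₁ ≠ y₃ ∧ y₂ ≠ y₃ := by
  by_contra! hnb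
  obtain ⟨a₁, ha₁, N₁, L₁, hN₁⟩ := hT.exists_ray_tail h₁ (p₁ 0)
  obtain ⟨a₂, ha₂, N₂, L₂, hN₂⟩ := hT.exists_ray_tail h₂ (p₁ 0)
  obtain ⟨a₃, ha₃, N₃, L₃, hN₃⟩ := hT.exists_ray_tail h₃ (p₁ 0)
  by_cases e₁₂ : a₁ = a₂
  · subst e₁₂
    exact h₁₂ (hT.sameEnd_of_no_branching hnb ha₁ h₁ hN₁ hN₂)
  by_cases e₁₃ : a₁ = a₃
  · subst e₁₃
    exact h₁₃ (hT.sameEnd_of_no_branching hnb ha₁ h₁ hN₁ hN₃)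
  obtain rfl := hnb _ _ _ _ ha₁ ha₂ ha₃ e₁₂ e₁₃
  exact h₂₃ (hT.sameEnd_of_no_branching hnb ha₂ h₂ hN₂ hN₃)

end SimpleGraph.IsTree

/-! ### Invariant convex sets of elliptic and cyclic subgroups -/

section Invariant

variable {G V : Type*} [Group G] [MulAction G V] {T : SimpleGraph V}

/-- Displacement is convex along geodesics: `y` separates `k • y` from `x` or `z`, and `k • y`
separates each of `x`, `z` from `k • x` or `k • z`. The triangle inequality settles every case. -/
theorem IsTreeAction.isGeodesicallyConvex_displacement (hT : IsTreeAction G T) (k : G) (m : ℕ) :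
    IsGeodesicallyConvex T {x | T.dist x (k • x) ≤ m} := by
  intro x hx z hz y hy
  simp only [Set.mem_ofPred_eq] at hx hz ⊢
  have hky := (hT.isBetween_smul k).2 hy
  have h1 := hT.isTree.isBetween_or_isBetween hy (k • y)
  have h2 := hT.isTree.isBetween_or_isBetween hky x
  have h3 := hT.isTree.isBetween_or_isBetween hky z
  have t1 := hT.isTree.1.dist_triangle (u := x) (v := z) (w := k • z)
  have t2 := hT.isTree.1.dist_triangle (u := z) (v := x) (w := k • x)
  have e1 := hT.dist_smul k x y
  have e2 := hT.dist_smul k y z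
  unfold IsBetween at *
  rw [T.dist_comm (u := k • y) (v := x), T.dist_comm (u := k • y) (v := z),
    T.dist_comm (u := k • y) (v := y)] at h1
  rw [T.dist_comm (u := k • y) (v := k • x)] at h2 h3
  rw [T.dist_comm (u := z) (v := x)] at t2
  rw [T.dist_comm (u := y) (v := x)] at h1
  omega

theorem IsTreeAction.exists_convex_of_actsElliptically (hT : IsTreeAction G T)
    (hgen : IsGeneralTypeAction G T) (K : Subgroup G) (hK : ActsElliptically V K) :
    ∃ A : Set V, IsGeodesicallyConvex T A ∧ A.Nonempty ∧ A ≠ Set.univ ∧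
      ∀ g ∈ K, ∀ x ∈ A, g • x ∈ A := by
  obtain ⟨w, hw⟩ := hK
  refine ⟨{w}, ?_, ⟨w, rfl⟩, fun h => ?_, ?_⟩
  · rintro x rfl z rfl y hy
    unfold IsBetween at hy
    rw [T.dist_self] at hy
    exact (hT.isTree.1.dist_eq_zero_iff.1 (by omega)).symm
  · refine hgen.no_fixed_vertex ⟨w, fun g => ?_⟩
    have : g • w ∈ ({w} : Set V) := h ▸ Set.mem_univ _
    exact this
  · rintro g hg x rfl
    exact hw g hg

/-- If the generator `k` fixes no vertex, `A` is its axis, the set of minimal displacement,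
preserved because `K` commutes with `k`. It is proper: at a branching vertex `z` some neighbour
avoids the directions of both `k • z` and `k⁻¹ • z`, and its displacement is larger by 2. -/
theorem IsTreeAction.exists_convex_of_isCyclic (hT : IsTreeAction G T)
    (hgen : IsGeneralTypeAction G T) (K : Subgroup G) (hK : IsCyclic K) :
    ∃ A : Set V, IsGeodesicallyConvex T A ∧ A.Nonempty ∧ A ≠ Set.univ ∧
      ∀ g ∈ K, ∀ x ∈ A, g • x ∈ A := by
  obtain ⟨⟨k, hkK⟩, hk⟩ := hK.exists_generator
  have hcomm : ∀ g ∈ K, k * g = g * k := by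
    intro g hg
    obtain ⟨n, hn⟩ := Subgroup.mem_zpowers_iff.1 (hk ⟨g, hg⟩)
    have : g = k ^ n := by simpa using (congrArg Subtype.val hn).symm
    rw [this]
    exact (Commute.refl k).zpow_right n
  obtain ⟨-, p₁, p₂, p₃, ⟨h₁, h₂, h₃⟩, ⟨h₁₂, h₁₃, h₂₃⟩, -⟩ := hgen.three_ends
  obtain ⟨z, y₁, y₂, y₃, hy₁, hy₂, hy₃, e₁₂, e₁₃, e₂₃⟩ :=
    hT.isTree.exists_branching h₁ h₂ h₃ h₁₂ h₁₃ h₂₃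
  have : Nonempty V := ⟨z⟩
  obtain ⟨x₀, hx₀⟩ : ∃ x₀ : V, ∀ x : V, T.dist x₀ (k • x₀) ≤ T.dist x (k • x) :=
    ⟨Function.argmin (fun x : V => T.dist x (k • x)),
      fun x => Function.argmin_le (fun x : V => T.dist x (k • x)) x⟩
  by_cases hfix : k • x₀ = x₀
  · refine hT.exists_convex_of_actsElliptically hgen K ⟨x₀, fun g hg => ?_⟩
    obtain ⟨n, hn⟩ := Subgroup.mem_zpowers_iff.1 (hk ⟨g, hg⟩)
    have hgn : g = k ^ n := by simpa using (congrArg Subtype.val hn).symm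
    have : k ^ n ∈ MulAction.stabilizer G x₀ := Subgroup.zpow_mem _ hfix n
    rwa [← hgn] at this
  refine ⟨_, hT.isGeodesicallyConvex_displacement k (T.dist x₀ (k • x₀)),
    ⟨x₀, le_refl (T.dist x₀ (k • x₀))⟩, fun huniv => ?_, ?_⟩
  · have hpos := hT.isTree.1.pos_dist_of_ne (Ne.symm hfix)
    have hall : ∀ x, T.dist x (k • x) = T.dist x₀ (k • x₀) := fun x =>
      le_antisymm (huniv ▸ Set.mem_univ x : x ∈ {x | T.dist x (k • x) ≤ T.dist x₀ (k • x₀)})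
        (hx₀ x)
    have hzk : ∀ w, z ≠ w → ∃ n, T.Adj z n ∧ ∀ y, T.Adj z y → y ≠ n →
        T.dist y w = 1 + T.dist z w := by
      intro w hw
      obtain ⟨n, hn, hwn⟩ := hT.isTree.exists_halfTree hw
      refine ⟨n, hn, fun y hy hyn => ?_⟩
      have h1 := hT.isTree.dist_adj hy w
      have h2 : ¬ T.dist w z = T.dist w y + 1 := fun h =>
        hyn (hT.isTree.eq_of_adj_of_mem_halfTree hy hn (mem_halfTree.2 (by omega)) hwn)
      rw [T.dist_comm, T.dist_comm (u := z)]
      omega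
    have hz1 : z ≠ k • z := by
      intro h
      have := hall z
      rw [← h, T.dist_self] at this
      omega
    have hz2 : z ≠ k⁻¹ • z := fun h => hz1 (by
      rw [eq_inv_smul_iff] at h
      exact h.symm)
    obtain ⟨n, hn, hn'⟩ := hzk _ hz1
    obtain ⟨n', -, hn''⟩ := hzk _ hz2
    obtain ⟨y, hy, hyn, hyn'⟩ : ∃ y, T.Adj z y ∧ y ≠ n ∧ y ≠ n' := by
      by_contra! hc
      by_cases a1 : y₁ = n
      · subst a1
        exact e₂₃ ((hc _ hy₂ e₁₂.symm).trans (hc _ hy₃ e₁₃.symm).symm)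
      · by_cases a2 : y₂ = n
        · subst a2
          exact e₁₃ ((hc _ hy₁ a1).trans (hc _ hy₃ e₂₃.symm).symm)
        · exact e₁₂ ((hc _ hy₁ a1).trans (hc _ hy₂ a2).symm)
    have d1 := hn' y hy hyn
    have d2 := hn'' y hy hyn'
    have d3 := hall z
    have d4 := hall y
    have d5 : T.dist y (k⁻¹ • z) = T.dist (k • y) z := (hT.dist_smul_left k y z).symm
    have d6 : T.dist z (k⁻¹ • z) = T.dist (k • z) z := (hT.dist_smul_left k z z).symm
    have d7 := T.dist_eq_one_iff_adj.2 hy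
    have d8 := hT.dist_smul k z y
    have hb : IsBetween T z (k • z) (k • y) := by
      unfold IsBetween
      rw [T.dist_comm, T.dist_comm (u := z)]
      omega
    have := hT.isTree.isBetween_or_isBetween hb y
    unfold IsBetween at this
    rw [T.dist_comm (u := y) (v := z), T.dist_comm (u := k • z) (v := z)] at this
    omega
  · intro g hg x hx
    simp only [Set.mem_ofPred_eq] at hx ⊢
    rwa [← mul_smul, hcomm g hg, mul_smul, hT.dist_smul]

end Invariant

/-! ### Chains in positive cones -/

section Chains

variable {G : Type*} [Group G]

theorem IsPositiveCone.comap_subtype {P : Set G} (hP : IsPositiveCone P) (L : Subgroup G) :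
    IsPositiveCone {x : L | (x : G) ∈ P} where
  mul_mem a ha b hb := hP.mul_mem a ha b hb
  cover g := by
    rcases hP.cover g with h | h | h
    exacts [Or.inl h, Or.inr (Or.inl h), Or.inr (Or.inr (Subtype.ext h))]
  disjoint_inv := by
    rw [Set.disjoint_left]
    intro a ha ha'
    exact Set.disjoint_left.1 hP.disjoint_inv ha (by simpa using ha')
  one_notMem := hP.one_notMem

theorem IsPositiveCone.conj {P : Set G} (hP : IsPositiveCone P) (M : G) :
    IsPositiveCone {x : G | M⁻¹ * x * M ∈ P} where
  mul_mem a ha b hb := by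
    have := hP.mul_mem _ ha _ hb
    simpa [mul_assoc] using this
  cover g := by
    have h1 : (M⁻¹ * g * M)⁻¹ = M⁻¹ * g⁻¹ * M := by group
    have h2 : M⁻¹ * g * M = 1 ↔ g = 1 :=
      ⟨fun h => by simpa [mul_assoc] using congrArg (fun x => M * x * M⁻¹) h, by rintro rfl; simp⟩
    have := hP.cover (M⁻¹ * g * M)
    rwa [Set.mem_inv, h1, h2] at this
  disjoint_inv := by
    rw [Set.disjoint_left]
    intro a ha ha'
    refine Set.disjoint_left.1 hP.disjoint_inv ha ?_
    rw [Set.mem_inv]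
    simpa [mul_assoc] using ha'
  one_notMem := by simpa using hP.one_notMem

theorem IsPositiveCone.exists_upper_bound [Nontrivial G] {P : Set G} (hP : IsPositiveCone P)
    {B : Set G} (hB : B.Finite) : ∃ M, ∀ x ∈ B, x⁻¹ * M ∈ P := by
  obtain ⟨p, hp⟩ : ∃ p, p ∈ P := by
    obtain ⟨g, hg⟩ := exists_ne (1 : G)
    rcases hP.cover g with h | h | h
    exacts [⟨_, h⟩, ⟨_, h⟩, absurd h hg]
  induction B, hB using Set.Finite.induction_on with
  | empty => exact ⟨1, by simp⟩
  | @insert x B _ _ ih =>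
    obtain ⟨M, hM⟩ := ih
    have key : M⁻¹ * x ∈ P ∨ M⁻¹ * x = 1 →
        ∃ M, ∀ y ∈ insert x B, y⁻¹ * M ∈ P := by
      intro h
      refine ⟨x * p, ?_⟩
      rintro y (rfl | hy)
      · simpa using hp
      · have e : y⁻¹ * (x * p) = (y⁻¹ * M) * ((M⁻¹ * x) * p) := by group
        rw [e]
        refine hP.mul_mem _ (hM y hy) _ ?_
        rcases h with h | h
        · exact hP.mul_mem _ h _ hp
        · rwa [h, one_mul]
    rcases hP.cover (M⁻¹ * x) with h | h | h
    · exact key (Or.inl h)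
    · refine ⟨M, ?_⟩
      rintro y (rfl | hy)
      · simpa using h
      · exact hM y hy
    · exact key (Or.inr h)

/-- Balls of a Cayley graph are finite. With the converse `exists_edist_le_of_finite`, this replaces
`r`-paths by paths with steps in a finite set, which can be compared between `G` and its subgroups.
-/
theorem exists_finite_of_edist_le {X : Set G} (hX : X.Finite) (r : ℕ) :
    ∃ E : Set G, E.Finite ∧ (∀ x ∈ E, x⁻¹ ∈ E) ∧
      ∀ x y : G, (SimpleGraph.mulCayley X).edist x y ≤ r → x⁻¹ * y ∈ E := by
  have key : ∀ r : ℕ, ∃ E : Set G, E.Finite ∧ ∀ x y : G,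
      ∀ p : (SimpleGraph.mulCayley X).Walk x y, p.length ≤ r → x⁻¹ * y ∈ E := by
    intro r
    induction r with
    | zero =>
      refine ⟨{1}, Set.finite_singleton 1, fun x y p hp => ?_⟩
      have := p.eq_of_length_eq_zero (by omega)
      simp [this]
    | succ r ih =>
      obtain ⟨E, hE, hEp⟩ := ih
      refine ⟨insert 1 (Set.image2 (fun a b => a * b) (X ∪ X⁻¹) E),
        ((hX.union hX.inv).image2 _ hE).insert 1, fun x y p hp => ?_⟩
      cases p with
      | nil => simp
      | @cons _ z _ hadj q =>
        right
        refine ⟨x⁻¹ * z, ?_, z⁻¹ * y, hEp _ _ q (by simpa using hp), by simp [mul_assoc]⟩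
        obtain ⟨-, g, hg, h | h⟩ := (SimpleGraph.mulCayley_adj' X x z).1 hadj
        · left
          simpa [← h] using hg
        · right
          simpa [h] using hg
  obtain ⟨E, hE, hEp⟩ := key r
  refine ⟨E ∪ E⁻¹, hE.union hE.inv, fun x hx => ?_, fun x y hxy => Or.inl ?_⟩
  · rcases hx with hx | hx
    · exact Or.inr (by simpa using hx)
    · exact Or.inl hx
  · obtain ⟨p, hp⟩ := SimpleGraph.exists_walk_of_edist_ne_top
      (ne_top_of_le_ne_top (ENat.natCast_ne_top r) hxy)
    rw [← hp] at hxy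
    exact hEp _ _ p (by exact_mod_cast hxy)

theorem exists_edist_le_of_finite {X : Set G} (hX : Subgroup.closure X = ⊤) {E : Set G}
    (hE : E.Finite) : ∃ r : ℕ, 0 < r ∧
      ∀ x y : G, x⁻¹ * y ∈ E → (SimpleGraph.mulCayley X).edist x y ≤ r := by
  have hreach : ∀ z x : G, (SimpleGraph.mulCayley X).Reachable x (x * z) := by
    intro z
    have hz : z ∈ Subgroup.closure X := hX ▸ Subgroup.mem_top z
    induction hz using Subgroup.closure_induction with
    | mem z hz =>
      intro x
      by_cases h : x = x * z
      · rw [← h]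
      · exact SimpleGraph.Adj.reachable
          ((SimpleGraph.mulCayley_adj' X _ _).2 ⟨h, z, hz, Or.inl rfl⟩)
    | one => intro x; rw [mul_one]
    | mul a b _ _ ha hb =>
      intro x
      rw [← mul_assoc]
      exact (ha x).trans (hb _)
    | inv a _ ha =>
      intro x
      simpa using (ha (x * a⁻¹)).symm
  have hbound : ∀ z : G, ∃ n : ℕ, ∀ x, (SimpleGraph.mulCayley X).edist x (x * z) ≤ n := by
    intro z
    obtain ⟨p⟩ := hreach z 1
    refine ⟨p.length, fun x => ?_⟩
    let f : SimpleGraph.mulCayley X →g SimpleGraph.mulCayley X :=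
      ⟨fun y => x * y, fun h => (SimpleGraph.mulCayley_adj_mul_iff_right).2 h⟩
    have h := SimpleGraph.edist_le (p.map f)
    rw [SimpleGraph.Walk.length_map] at h
    have h1 : f 1 = x := mul_one x
    have h2 : f (1 * z) = x * z := by
      show x * (1 * z) = x * z
      rw [one_mul]
    rwa [h1, h2] at h
  choose f hf using hbound
  obtain ⟨N, hN⟩ := (hE.image f).bddAbove
  refine ⟨N + 1, Nat.succ_pos _, fun x y hxy => ?_⟩
  have h1 := hf (x⁻¹ * y) x
  rw [mul_inv_cancel_left] at h1
  have h2 : f (x⁻¹ * y) ≤ N + 1 := (hN ⟨_, hxy, rfl⟩).trans (Nat.le_succ N)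
  exact h1.trans (by exact_mod_cast h2)

/-- `x` and `y` are elements of `A` that differ by right multiplication by an element of `E`. -/
def ChainStep (A E : Set G) (x y : G) : Prop :=
  x ∈ A ∧ y ∈ A ∧ x⁻¹ * y ∈ E

theorem reflTransGen_chainStep_mono {A E E' : Set G} (h : E ⊆ E') {x y : G}
    (hxy : Relation.ReflTransGen (ChainStep A E) x y) :
    Relation.ReflTransGen (ChainStep A E') x y := by
  induction hxy with
  | refl => exact Relation.ReflTransGen.refl
  | tail _ hbc ih => exact ih.tail ⟨hbc.1, hbc.2.1, h hbc.2.2⟩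

/-- Left cosets of a Prieto subgroup meet a positive cone in a coarsely connected set. -/
theorem IsPrieto.exists_chain {L : Subgroup G} (hL : IsPrieto L) {Q : Set G}
    (hQ : IsPositiveCone Q) :
    ∃ E : Set G, E.Finite ∧ E ⊆ L ∧ ∀ x ∈ Q, ∀ y ∈ Q, x⁻¹ * y ∈ L →
      Relation.ReflTransGen (ChainStep Q E) x y := by
  obtain ⟨-, X, hX, -, hconn⟩ := hL
  obtain ⟨r, -, hr⟩ := hconn _ (hQ.comap_subtype L)
  obtain ⟨E, hE, hEinv, hEr⟩ := exists_finite_of_edist_le hX r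
  by_cases hex : ∃ q : L, (q : G) ∈ Q
  · obtain ⟨q, hq⟩ := hex
    -- The step `q` leads from `x` to `x * q`; from there the left translate by `x` of a path from
    -- `q` to `l` takes over, and stays in `Q` because `Q` is a semigroup.
    let F : Set G := Subtype.val '' (E ∪ {q, q⁻¹})
    have hFinv : ∀ x ∈ F, x⁻¹ ∈ F := by
      rintro _ ⟨x, hx, rfl⟩
      refine ⟨x⁻¹, ?_, rfl⟩
      rcases hx with hx | rfl | rfl
      · exact Or.inl (hEinv x hx)
      · exact Or.inr (Or.inr rfl)
      · exact Or.inr (Or.inl (inv_inv q))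
    have hsymm : Std.Symm (ChainStep Q F) := ⟨by
      rintro x y ⟨hx, hy, h⟩
      refine ⟨hy, hx, ?_⟩
      simpa using hFinv _ h⟩
    have key : ∀ x ∈ Q, ∀ l : L, (l : G) ∈ Q →
        Relation.ReflTransGen (ChainStep Q F) x (x * l) := by
      intro x hx l hl
      obtain ⟨n, γ, hγ, h0, hn, hmem⟩ := hr q hq l hl
      have hi : ∀ i ≤ n, Relation.ReflTransGen (ChainStep Q F) x (x * γ i) := by
        intro i
        induction i with
        | zero =>
          intro _
          refine Relation.ReflTransGen.single ⟨hx, hQ.mul_mem _ hx _ (hmem 0 (Nat.zero_le _)), ?_⟩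
          rw [h0, inv_mul_cancel_left]
          exact ⟨q, Or.inr (Or.inl rfl), rfl⟩
        | succ i ih =>
          intro hi
          refine (ih (by omega)).tail ⟨hQ.mul_mem _ hx _ (hmem i (by omega)),
            hQ.mul_mem _ hx _ (hmem _ hi), ?_⟩
          refine ⟨_, Or.inl (hEr _ _ (hγ i (by omega))), ?_⟩
          push_cast
          group
      have := hi n le_rfl
      rwa [hn] at this
    refine ⟨F, (hE.union (by simp)).image _, ?_, fun x hx y hy hxy => ?_⟩
    · rintro _ ⟨x, -, rfl⟩
      exact x.2
    · rcases hQ.cover (x⁻¹ * y) with h | h | h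
      · simpa using key x hx ⟨_, hxy⟩ h
      · have h' : y⁻¹ * x ∈ L := by simpa using L.inv_mem hxy
        have := key y hy ⟨_, h'⟩ (by simpa using h)
        rw [mul_inv_cancel_left] at this
        exact Relation.ReflTransGen.stdSymm.symm _ _ this
      · rw [inv_mul_eq_one] at h
        rw [h]
  · push Not at hex
    -- Here `L` has no positive element, so it is trivial and its cosets are points.
    refine ⟨∅, Set.finite_empty, Set.empty_subset _, fun x hx y hy hxy => ?_⟩
    rcases hQ.cover (x⁻¹ * y) with h | h | h
    · exact absurd h (hex ⟨_, hxy⟩)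
    · exact absurd h (hex ⟨_, L.inv_mem hxy⟩)
    · rw [inv_mul_eq_one] at h
      rw [h]

theorem exists_path_of_chain {L : Subgroup G} {X : Set L} {Q E : Set G} (hEL : E ⊆ L) {r : ℕ}
    (hr : ∀ x y : L, x⁻¹ * y ∈ {z : L | (z : G) ∈ E} →
      (SimpleGraph.mulCayley X).edist x y ≤ r) {a : L} (ha : (a : G) ∈ Q) {b : G}
    (h : Relation.ReflTransGen (ChainStep Q E) a b) :
    ∃ (n : ℕ) (γ : ℕ → L), IsRPath (SimpleGraph.mulCayley X) r n γ ∧ γ 0 = a ∧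
      (γ n : G) = b ∧ ∀ i ≤ n, (γ i : G) ∈ Q := by
  induction h with
  | refl => exact ⟨0, fun _ => a, fun i hi => by omega, rfl, rfl, fun _ _ => ha⟩
  | @tail b c _ hbc ih =>
    obtain ⟨n, γ, hγ, h0, hn, hmem⟩ := ih
    obtain ⟨-, hcQ, hc⟩ := hbc
    have hcL : c ∈ L := by
      have := L.mul_mem (γ n).2 (hEL hc)
      rwa [hn, mul_inv_cancel_left] at this
    refine ⟨n + 1, fun i => if i ≤ n then γ i else ⟨c, hcL⟩, fun i hi => ?_, by simpa using h0,
      by simp, fun i hi => ?_⟩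
    · rcases Nat.lt_succ_iff_lt_or_eq.1 hi with h | rfl
      · have h1 : i ≤ n := h.le
        have h2 : i + 1 ≤ n := h
        simpa only [h1, h2, if_true] using hγ i h
      · simp only [le_refl, if_true, Nat.not_succ_le_self, if_false]
        apply hr
        show ((γ i)⁻¹ * ⟨c, hcL⟩ : L).1 ∈ E
        simpa [hn] using hc
    · by_cases h : i ≤ n
      · simpa only [h, if_true] using hmem i h
      · simpa only [h, if_false] using hcQ

/-- A chain in `Q` is an `r`-path in `L` avoiding the negative cone, hence the swamp between the two
cosets. -/
theorem IsHucha.exists_forall_not_chain {L : Subgroup G} {H : Subgroup L}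
    (hL : IsHucha L {H}) {Q : Set G} (hQ : IsPositiveCone Q) {E : Set G} (hE : E.Finite)
    (hEL : E ⊆ L) :
    ∃ g₁ g₂ : L, ∀ x y : L, g₁⁻¹ * x ∈ H → g₂⁻¹ * y ∈ H → (x : G) ∈ Q →
      ¬ Relation.ReflTransGen (ChainStep Q E) (x : G) y := by
  obtain ⟨-, X, -, hX, hswamp⟩ := hL
  obtain ⟨r, hr0, hr⟩ := exists_edist_le_of_finite hX
    (hE.preimage (f := (Subtype.val : L → G)) Subtype.val_injective.injOn)
  obtain ⟨S, hS, -, g₁, g₂, hg⟩ := hswamp _ (hQ.comap_subtype L) H rfl r hr0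
  refine ⟨g₁, g₂, fun x y hx hy hxQ hxy => ?_⟩
  obtain ⟨n, γ, hγ, h0, hn, hmem⟩ := exists_path_of_chain hEL hr hxQ hxy
  obtain ⟨i, hi, hiS⟩ := hg n γ hγ ⟨_, hx, by rw [h0]; group⟩
    ⟨_, hy, by rw [Subtype.val_injective hn]; group⟩
  exact Set.disjoint_left.1 (hQ.comap_subtype L).disjoint_inv (hmem i hi) (hS hiS)

end Chains

/-! ### Half-trees separated by the complement of a positive cone -/

section Separation

variable {G V : Type*} [Group G] [MulAction G V] {T : SimpleGraph V}

theorem IsTreeAction.mem_edgeStabilizer (hT : IsTreeAction G T) {v n : V} (h : T.Adj v n) {g : G} :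
    g ∈ edgeStabilizer G s(v, n) ↔ g • v = v ∧ g • n = n := by
  change Sym2.map (fun x => g • x) s(v, n) = s(v, n) ↔ _
  rw [Sym2.map_mk, Sym2.eq_iff]
  exact or_iff_left (hT.no_inversion g v n h)

/-- A choice of orbit representatives with a prescribed one. -/
theorem exists_orbit_representatives (L : Subgroup G) (n₀ : V) :
    ∃ (ρ : V → V) (τ : V → G), (∀ x, τ x ∈ L) ∧ (∀ x, τ x • ρ x = x) ∧
      (∀ g ∈ L, ∀ x, ρ (g • x) = ρ x) ∧ ρ n₀ = n₀ := by
  classical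
  let mk : V → Quotient (MulAction.orbitRel L V) := Quotient.mk _
  let r : Quotient (MulAction.orbitRel L V) → V := Function.update Quotient.out (mk n₀) n₀
  have hr : ∀ q, mk (r q) = q := by
    intro q
    by_cases h : q = mk n₀
    · subst h
      simp [r]
    · simp only [r, Function.update_of_ne h]
      exact Quotient.out_eq q
  have hex : ∀ x, ∃ t : G, t ∈ L ∧ t • r (mk x) = x := by
    intro x
    obtain ⟨t, ht⟩ := MulAction.orbitRel_apply.1 (Quotient.exact (hr (mk x)).symm)
    exact ⟨t, t.2, ht⟩
  choose τ hτ hτ' using hex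
  refine ⟨fun x => r (mk x), τ, hτ, hτ', fun g hg x => ?_, by simp [r]⟩
  have : mk (g • x) = mk x :=
    Quotient.sound (MulAction.orbitRel_apply.2 ⟨(⟨g, hg⟩ : L), rfl⟩)
  simp only [this]

/-- An element `g` from which a short step jumps over `v` is close to an element of the stabilizer
of `v` that carries a representative to the direction of `g • v`. -/
theorem IsTreeAction.exists_markers (hT : IsTreeAction G T) (v : V) {ρ : V → V} {τ : V → G}
    (hτ : ∀ x, τ x ∈ MulAction.stabilizer G v) (hτρ : ∀ x, τ x • ρ x = x)
    (hρ : ∀ g ∈ MulAction.stabilizer G v, ∀ x, ρ (g • x) = ρ x) {E : Set G} (hE : E.Finite) :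
    ∃ (B : Set G) (F : Set V), B.Finite ∧ F.Finite ∧ 1 ∈ B ∧ ∀ g b, b ∈ E →
      IsBetween T (g • v) v ((g * b) • v) → ∀ n, T.Adj v n → g • v ∈ halfTree T v n →
        ∃ x : G, x • v = v ∧ x • ρ n = n ∧ x⁻¹ * g ∈ B ∧ ρ n ∈ F := by
  -- When `v` lies between `g • v` and `(g * b) • v`, both `g⁻¹ • v` and `g⁻¹ • n` lie in this
  -- finite set, which bounds the possible corrections and representatives.
  let W : Set V := ⋃ b ∈ E, {y | IsBetween T v y (b • v)}
  have hW : W.Finite := hE.biUnion fun b _ => hT.isTree.finite_isBetween v (b • v)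
  have hc : ∀ y : V, ∃ c : G, (∃ g : G, g • v = y) → c • v = y := by
    intro y
    by_cases h : ∃ g : G, g • v = y
    · exact ⟨h.choose, fun _ => h.choose_spec⟩
    · exact ⟨1, fun h' => absurd h' h⟩
  choose c hc using hc
  refine ⟨insert 1 (Set.image2 (fun y w => (τ ((c y)⁻¹ • w))⁻¹ * (c y)⁻¹) W W),
    Set.image2 (fun y w => ρ ((c y)⁻¹ • w)) W W, (hW.image2 _ hW).insert 1, hW.image2 _ hW,
    Set.mem_insert _ _, fun g b hb hbet n hn hgn => ?_⟩
  have hbetn : IsBetween T (g • v) n ((g * b) • v) := by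
    have h1 := hT.isTree.dist_of_mem_halfTree hn hgn
    have h2 := hT.isTree.1.dist_triangle (u := n) (v := v) (w := (g * b) • v)
    have h3 := hT.isTree.1.dist_triangle (u := g • v) (v := n) (w := (g * b) • v)
    have h4 := T.dist_eq_one_iff_adj.2 hn.symm
    unfold IsBetween at *
    omega
  have hWmem : ∀ y, IsBetween T (g • v) y ((g * b) • v) → g⁻¹ • y ∈ W := by
    intro y hy
    refine Set.mem_biUnion hb ?_
    rw [mul_smul] at hy
    simpa using (hT.isBetween_smul g⁻¹).2 hy
  have hcy := hc (g⁻¹ • v) ⟨g⁻¹, rfl⟩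
  -- `k` moves `v` to `g⁻¹ • v`, so `g * k` fixes `v`; the factor `t` then adjusts the direction,
  -- giving the marker `g * k * t`.
  set k := c (g⁻¹ • v) with hk
  set t := τ (k⁻¹ • g⁻¹ • n) with ht
  have hgk : g * k ∈ MulAction.stabilizer G v := by
    rw [MulAction.mem_stabilizer_iff, mul_smul, hcy, smul_inv_smul]
  have hinv : k⁻¹ • g⁻¹ • n = (g * k)⁻¹ • n := by rw [mul_inv_rev, mul_smul]
  have hρn : ρ (k⁻¹ • g⁻¹ • n) = ρ n := by
    rw [hinv, hρ _ (Subgroup.inv_mem _ hgk)]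
  refine ⟨g * k * t, ?_, ?_, Or.inr ⟨_, hWmem v hbet, _, hWmem n hbetn, ?_⟩,
    ⟨_, hWmem v hbet, _, hWmem n hbetn, hρn⟩⟩
  · exact Subgroup.mul_mem _ hgk (hτ _)
  · rw [mul_smul, ← hρn, ht, hτρ, hinv, smul_inv_smul]
  · simp only [← hk, ← ht]
    group

/-- The half-trees are the branches at `v` towards `g₁ • n₀` and `g₂ • n₀`, moved by `M⁻¹`, except
when these directions coincide. The proof propagates `Φ`: the path is still in the first branch, or
is at `v` inside `C`, or is in a branch marked by an element of `C`. -/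
theorem IsTreeAction.exists_separated_halfTrees [Nontrivial G] (hT : IsTreeAction G T)
    {v n₀ : V} (hn₀ : T.Adj v n₀)
    (hHucha : IsHucha (MulAction.stabilizer G v)
      {(edgeStabilizer G s(v, n₀)).subgroupOf (MulAction.stabilizer G v)})
    (hPrieto : ∀ n, T.Adj v n → IsPrieto (edgeStabilizer G s(v, n)))
    {P : Set G} (hP : IsPositiveCone P) {E : Set G} (hE : E.Finite) (hEinv : ∀ x ∈ E, x⁻¹ ∈ E) :
    ∃ a₁ b₁ a₂ b₂ : V, T.Adj a₁ b₁ ∧ T.Adj a₂ b₂ ∧ ∀ (n : ℕ) (γ : ℕ → G),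
      (∀ i < n, (γ i)⁻¹ * γ (i + 1) ∈ E) → γ 0 • v ∈ halfTree T a₁ b₁ →
      γ n • v ∈ halfTree T a₂ b₂ → ∃ i ≤ n, γ i ∈ P⁻¹ := by
  obtain ⟨ρ, τ, hτ, hτρ, hρ, hρn₀⟩ :=
    exists_orbit_representatives (MulAction.stabilizer G v) n₀
  obtain ⟨B, F, hB, hF, hB1, hmark⟩ := hT.exists_markers v hτ hτρ hρ hE
  obtain ⟨M, hM⟩ := hP.exists_upper_bound hB
  have hQ := hP.conj M
  set Q : Set G := {x : G | M⁻¹ * x * M ∈ P}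
  -- the finite set of chain steps
  have hchain : ∀ q : V, ∃ D : Set G, D.Finite ∧ D ⊆ MulAction.stabilizer G v ∧
      (T.Adj v q → ∀ x ∈ Q, ∀ y ∈ Q, x⁻¹ * y ∈ edgeStabilizer G s(v, q) →
        Relation.ReflTransGen (ChainStep Q D) x y) := by
    intro q
    by_cases hq : T.Adj v q
    · obtain ⟨D, hD, hDsub, hDc⟩ := (hPrieto q hq).exists_chain hQ
      exact ⟨D, hD, fun x hx => ((hT.mem_edgeStabilizer hq).1 (hDsub hx)).1, fun _ => hDc⟩
    · exact ⟨∅, Set.finite_empty, Set.empty_subset _, fun h => absurd h hq⟩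
  choose D hD hDsub hDc using hchain
  -- Steps of the first kind join markers of one branch; steps of the second kind join markers on
  -- the two sides of a crossing of `v`.
  let D' : Set G := (⋃ q ∈ F, D q) ∪
    (Set.image2 (fun x y => x * y⁻¹) (Set.image2 (fun x y => x * y) B E) B ∩
      {x | x ∈ MulAction.stabilizer G v})
  have hD' : D'.Finite := (hF.biUnion fun q _ => hD q).union
    (((hB.image2 _ hE).image2 _ hB).inter_of_left _)
  have hD'sub : D' ⊆ MulAction.stabilizer G v := by
    rintro x (hx | hx)
    · obtain ⟨q, -, hq⟩ := Set.mem_iUnion₂.1 hx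
      exact hDsub q hq
    · exact hx.2
  obtain ⟨⟨g₁, hg₁⟩, ⟨g₂, hg₂⟩, hg⟩ := hHucha.exists_forall_not_chain hQ hD' hD'sub
  have hadj : ∀ {g : G}, g • v = v → T.Adj v (g • n₀) := by
    intro g hg
    have := hT.smul_adj g _ _ hn₀
    rwa [hg] at this
  have hg₁v : g₁ • v = v := hg₁
  have hg₂v : g₂ • v = v := hg₂
  -- the elements that are joined to the first coset
  let C : Set G := {y | y ∈ Q ∧ y • v = v ∧ ∃ x ∈ Q, x • v = v ∧ x • n₀ = g₁ • n₀ ∧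
    Relation.ReflTransGen (ChainStep Q D') x y}
  have hC₁ : ∀ x ∈ Q, x • v = v → x • n₀ = g₁ • n₀ → x ∈ C := fun x hx hxv hxn =>
    ⟨hx, hxv, x, hx, hxv, hxn, Relation.ReflTransGen.refl⟩
  have hC₂ : ∀ x ∈ C, ∀ y ∈ Q, y • v = v → Relation.ReflTransGen (ChainStep Q D') x y →
      y ∈ C := by
    rintro x ⟨-, -, z, hz, hzv, hzn, hzx⟩ y hy hyv hxy
    exact ⟨hy, hyv, z, hz, hzv, hzn, hzx.trans hxy⟩
  have hC₃ : ∀ x ∈ C, x • n₀ ≠ g₂ • n₀ := by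
    rintro x ⟨hx, hxv, z, hz, hzv, hzn, hzx⟩ hxn
    refine hg ⟨z, hzv⟩ ⟨x, hxv⟩ ?_ ?_ hz hzx
    · rw [Subgroup.mem_subgroupOf, hT.mem_edgeStabilizer hn₀]
      change (g₁⁻¹ * z) • v = v ∧ (g₁⁻¹ * z) • n₀ = n₀
      rw [mul_smul, mul_smul, inv_smul_eq_iff, inv_smul_eq_iff]
      exact ⟨hzv.trans hg₁v.symm, hzn⟩
    · rw [Subgroup.mem_subgroupOf, hT.mem_edgeStabilizer hn₀]
      change (g₂⁻¹ * x) • v = v ∧ (g₂⁻¹ * x) • n₀ = n₀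
      rw [mul_smul, mul_smul, inv_smul_eq_iff, inv_smul_eq_iff]
      exact ⟨hxv.trans hg₂v.symm, hxn⟩
  have hC₄ : ∀ x ∈ C, ∀ y ∈ Q, y • v = v → ∀ q ∈ F, T.Adj v q → x • q = y • q → y ∈ C := by
    intro x hx y hy hyv q hqF hq hxy
    refine hC₂ x hx y hy hyv ?_
    have hxy' : x⁻¹ * y ∈ edgeStabilizer G s(v, q) := by
      rw [hT.mem_edgeStabilizer hq, mul_smul, mul_smul, inv_smul_eq_iff, inv_smul_eq_iff]
      exact ⟨hyv.trans hx.2.1.symm, hxy.symm⟩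
    exact reflTransGen_chainStep_mono (fun z hz => Or.inl (Set.mem_biUnion hqF hz))
      (hDc q hq x hx.1 y hy hxy')
  have hD'mem : ∀ x y a b : G, x • v = v → y • v = v → x⁻¹ * a ∈ B → y⁻¹ * b ∈ B →
      a⁻¹ * b ∈ E → x⁻¹ * y ∈ D' := by
    intro x y a b hx hy hxa hyb hab
    refine Or.inr ⟨⟨_, ⟨_, hxa, _, hab, rfl⟩, _, hyb, ?_⟩, ?_⟩
    · group
    · exact Subgroup.mul_mem (MulAction.stabilizer G v) (Subgroup.inv_mem _ hx) hy
  -- With `b = x⁻¹ * g`, one has `M⁻¹ * x * M = (M⁻¹ * g) * (b⁻¹ * M)`: the first factor is positive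
  -- or trivial, the second positive by the choice of `M`.
  have hpos : ∀ g : G, M⁻¹ * g ∉ P⁻¹ → ∀ x, x⁻¹ * g ∈ B → x ∈ Q := by
    intro g hg x hx
    by_contra hxQ
    have h1 : M⁻¹ * x⁻¹ * M ∈ P ∨ x = 1 := (hQ.cover x).resolve_left hxQ
    have h2 := hM _ hx
    refine hg ?_
    rw [Set.mem_inv]
    have e : (M⁻¹ * g)⁻¹ = ((x⁻¹ * g)⁻¹ * M) * (M⁻¹ * x⁻¹ * M) := by group
    rw [e]
    rcases h1 with h1 | rfl
    · exact hP.mul_mem _ h2 _ h1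
    · simpa using h2
  -- the invariant along a path
  let Φ : G → Prop := fun g => g • v ∈ halfTree T v (g₁ • n₀) ∨ (g • v = v ∧ g ∈ C) ∨
    ∃ m, T.Adj v m ∧ g • v ∈ halfTree T v m ∧ ρ m ∈ F ∧ ∃ x ∈ C, x • ρ m = m
  have hadjρ : ∀ m (x : G), T.Adj v m → x • v = v → x • ρ m = m → T.Adj v (ρ m) := by
    intro m x hm hx hxm
    rw [← hT.adj_smul_iff x, hx, hxm]
    exact hm
  have hstep : ∀ g g' : G, M⁻¹ * g ∉ P⁻¹ → M⁻¹ * g' ∉ P⁻¹ → g⁻¹ * g' ∈ E → Φ g → Φ g' := by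
    intro g g' hgP hgP' hgg' hΦ
    by_cases hbet : IsBetween T (g • v) v (g' • v)
    -- The marker before the crossing is in `C`: by definition in the first branch, as `g` itself at
    -- `v`, and by the Prieto chains in a marked branch.
    · obtain ⟨x, hxC, hxg⟩ : ∃ x ∈ C, x⁻¹ * g ∈ B := by
        have hbet' : IsBetween T (g • v) v ((g * (g⁻¹ * g')) • v) := by
          rwa [mul_inv_cancel_left]
        rcases hΦ with h | ⟨-, h⟩ | ⟨m, hm, hgm, hmF, x, hxC, hxm⟩
        · obtain ⟨x, hxv, hxn, hxB, -⟩ := hmark g _ hgg' hbet' _ (hadj hg₁v) h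
          rw [hρ g₁ hg₁, hρn₀] at hxn
          exact ⟨x, hC₁ x (hpos g hgP x hxB) hxv hxn, hxB⟩
        · exact ⟨g, h, by rwa [inv_mul_cancel]⟩
        · obtain ⟨y, hyv, hyn, hyB, -⟩ := hmark g _ hgg' hbet' m hm hgm
          exact ⟨y, hC₄ x hxC y (hpos g hgP y hyB) hyv _ hmF (hadjρ m y hm hyv hyn)
            (hxm.trans hyn.symm), hyB⟩
      have hnext : ∀ y, y • v = v → y⁻¹ * g' ∈ B → y ∈ C := by
        intro y hyv hyB
        have hyQ := hpos g' hgP' y hyB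
        exact hC₂ x hxC y hyQ hyv (Relation.ReflTransGen.single
          ⟨hxC.1, hyQ, hD'mem x y g g' hxC.2.1 hyv hxg hyB hgg'⟩)
      by_cases hg'v : g' • v = v
      · exact Or.inr (Or.inl ⟨hg'v, hnext g' hg'v (by rwa [inv_mul_cancel])⟩)
      · obtain ⟨m, hm, hgm⟩ := hT.isTree.exists_halfTree (Ne.symm hg'v)
        have hbet' : IsBetween T (g' • v) v ((g' * (g⁻¹ * g')⁻¹) • v) := by
          have e : g' * (g⁻¹ * g')⁻¹ = g := by group
          rw [e]
          exact hbet.symm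
        obtain ⟨y, hyv, hyn, hyB, hmF⟩ := hmark g' _ (hEinv _ hgg') hbet' m hm hgm
        exact Or.inr (Or.inr ⟨m, hm, hgm, hmF, y, hnext y hyv hyB, hyn⟩)
    · rcases hΦ with h | ⟨h, -⟩ | ⟨m, hm, hgm, hmF, h⟩
      · exact Or.inl (hT.isTree.mem_halfTree_of_not_isBetween (hadj hg₁v) h hbet)
      · rw [h] at hbet
        exact absurd (isBetween_left _ _) hbet
      · exact Or.inr (Or.inr ⟨m, hm, hT.isTree.mem_halfTree_of_not_isBetween hm hgm hbet, hmF, h⟩)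
  have hpath : ∀ (n : ℕ) (γ : ℕ → G), (∀ i < n, (γ i)⁻¹ * γ (i + 1) ∈ E) →
      (∀ i ≤ n, γ i ∉ P⁻¹) → (M * γ 0) • v ∈ halfTree T v (g₁ • n₀) → Φ (M * γ n) := by
    intro n γ hγ hγP h0
    have : ∀ i ≤ n, Φ (M * γ i) := by
      intro i
      induction i with
      | zero => exact fun _ => Or.inl h0
      | succ i ih =>
        intro hi
        refine hstep _ _ ?_ ?_ ?_ (ih (by omega))
        · simpa using hγP i (by omega)
        · simpa using hγP (i + 1) hi
        · simpa [mul_assoc] using hγ i hi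
    exact this n le_rfl
  have htrans : ∀ (g : G) (a b : V),
      g • v ∈ halfTree T (M⁻¹ • a) (M⁻¹ • b) → (M * g) • v ∈ halfTree T a b := by
    intro g a b h
    rw [← hT.smul_mem_halfTree M, smul_inv_smul, smul_inv_smul] at h
    rwa [mul_smul]
  have hadj₁ := (hT.adj_smul_iff M⁻¹).2 (hadj hg₁v)
  have hadj₂ := (hT.adj_smul_iff M⁻¹).2 (hadj hg₂v)
  by_cases hcase : g₁ • n₀ = g₂ • n₀
  -- If the directions coincide, chains of length zero show that the coset misses `Q`. Then `C` is
  -- empty, the path never leaves the first branch, and the complementary half-tree serves as the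
  -- second.
  · refine ⟨M⁻¹ • v, M⁻¹ • g₁ • n₀, M⁻¹ • g₁ • n₀, M⁻¹ • v, hadj₁, hadj₁.symm,
      fun n γ hγ h0 hn => ?_⟩
    by_contra! hγP
    have hCempty : ∀ x, x ∉ C := by
      rintro x ⟨-, -, z, hz, hzv, hzn, -⟩
      exact hC₃ z (hC₁ z hz hzv hzn) (hzn.trans hcase)
    rcases hpath n γ hγ hγP (htrans _ _ _ h0) with h | ⟨-, h⟩ | ⟨m, -, -, -, x, hxC, -⟩
    · exact (hT.isTree.notMem_halfTree (hadj hg₁v)).2 (htrans _ _ _ hn) h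
    · exact hCempty _ h
    · exact hCempty _ hxC
  · refine ⟨M⁻¹ • v, M⁻¹ • g₁ • n₀, M⁻¹ • v, M⁻¹ • g₂ • n₀, hadj₁, hadj₂,
      fun n γ hγ h0 hn => ?_⟩
    by_contra! hγP
    have hn' := htrans _ _ _ hn
    rcases hpath n γ hγ hγP (htrans _ _ _ h0) with h | ⟨h, -⟩ | ⟨m, hm, hgm, -, x, hxC, hxm⟩
    · exact hcase (hT.isTree.eq_of_adj_of_mem_halfTree (hadj hg₁v) (hadj hg₂v) h hn')
    · rw [h] at hn'
      exact left_notMem_halfTree _ _ hn'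
    · obtain rfl := hT.isTree.eq_of_adj_of_mem_halfTree hm (hadj hg₂v) hgm hn'
      rw [hρ g₂ hg₂, hρn₀] at hxm
      exact hC₃ x hxC hxm

/-- Every half-tree contains a translate of `v` by a positive element. -/
theorem IsTreeAction.exists_pos_smul_mem_halfTree (hT : IsTreeAction G T)
    (hmin : IsMinimalAction G T) (hend : ¬ FixesEnd G T) {P : Set G} (hP : IsPositiveCone P)
    (v : V) {a b : V} (h : T.Adj a b) : ∃ u ∈ P, u • v ∈ halfTree T a b := by
  -- This depth leaves `v` outside. A flip `g` then puts both `g • v` and `g⁻¹ • v` inside, and one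
  -- of `g`, `g⁻¹` is positive.
  obtain ⟨a', b', hadj, hsub, hd⟩ := hT.exists_deep_halfTree hmin h (T.dist a v)
  have ha : a ∈ halfTree T b' a' := by
    rw [← hT.isTree.notMem_halfTree hadj]
    exact fun hmem => left_notMem_halfTree a b (hsub hmem)
  have hv : v ∈ halfTree T b' a' := by
    rw [← hT.isTree.notMem_halfTree hadj]
    intro hv
    have := hT.isTree.dist_of_mem_halfTrees hadj ha hv
    omega
  obtain ⟨g, hg⟩ := hT.exists_flip hmin hend hadj
  have hg' : g⁻¹ • v ∈ halfTree T a' b' := by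
    by_contra hc
    have := hg _ ((hT.isTree.notMem_halfTree hadj).1 hc)
    rw [smul_inv_smul] at this
    exact (hT.isTree.notMem_halfTree hadj).2 hv this
  rcases hP.cover g with h1 | h1 | h1
  · exact ⟨g, h1, hsub (hg v hv)⟩
  · exact ⟨g⁻¹, h1, hsub hg'⟩
  · have := hg v hv
    rw [h1, one_smul] at this
    exact absurd this ((hT.isTree.notMem_halfTree hadj).2 hv)

/-- Every half-tree contains the translate of `v` by some left coset of a subgroup that preserves a
proper convex set. -/
theorem IsTreeAction.exists_coset_smul_mem_halfTree (hT : IsTreeAction G T)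
    (hmin : IsMinimalAction G T) (hend : ¬ FixesEnd G T) {K : Subgroup G} {A : Set V}
    (hA : IsGeodesicallyConvex T A) (hne : A.Nonempty) (hproper : A ≠ Set.univ)
    (hK : ∀ g ∈ K, ∀ x ∈ A, g • x ∈ A) (v : V) {a b : V} (h : T.Adj a b) :
    ∃ g : G, ∀ k ∈ K, (g * k) • v ∈ halfTree T a b := by
  obtain ⟨s, hs⟩ := hne
  -- The points `(g * k) • s` will lie in the deep half-tree, and `(g * k) • v` is only `T.dist v s`
  -- away from them.
  obtain ⟨a', b', hadj, hsub, hd⟩ := hT.exists_deep_halfTree hmin h (T.dist v s)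
  have ha : a ∈ halfTree T b' a' := by
    rw [← hT.isTree.notMem_halfTree hadj]
    exact fun hmem => left_notMem_halfTree a b (hsub hmem)
  obtain ⟨g, hg⟩ := hT.exists_smul_subset_halfTree hmin hend hadj hA hproper
  refine ⟨g, fun k hk => ?_⟩
  by_contra hc
  have hgs : (g * k) • s ∈ halfTree T a' b' := by
    rw [mul_smul]
    exact hg _ (hK k hk s hs)
  have h1 := hT.isTree.dist_of_mem_halfTrees h ((hT.isTree.notMem_halfTree h).1 hc) (hsub hgs)
  have h2 := hT.isTree.dist_of_mem_halfTrees hadj ha hgs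
  have h3 := hT.isTree.dist_of_mem_halfTree h (hsub hgs)
  rw [T.dist_comm, T.dist_comm (v := b)] at h3
  rw [hT.dist_smul] at h1
  omega

end Separation

theorem mainTheorem2 {G V : Type*} [Group G] [MulAction G V] (T : SimpleGraph V)
    (hG : Group.FG G) (hord : IsLeftOrderable G)
    (hT : IsTreeAction G T) (hcof : IsCofiniteAction G T) (hmin : IsMinimalAction G T)
    (hgen : IsGeneralTypeAction G T)
    (hstab : ∀ w : V, (MulAction.stabilizer G w).FG)
    (v : V) (e : Sym2 V) (he : e ∈ T.incidenceSet v)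
    (hHucha : IsHucha (MulAction.stabilizer G v)
      {(edgeStabilizer G e).subgroupOf (MulAction.stabilizer G v)})
    (hPrieto : ∀ e' ∈ T.incidenceSet v, IsPrieto (edgeStabilizer G e')) :
    IsHucha G {K : Subgroup G | IsCyclic K ∨ ActsElliptically V K} := by
  obtain ⟨n₀, rfl⟩ := Sym2.mem_iff_exists.1 he.2
  have hn₀ : T.Adj v n₀ := he.1
  have hnontriv : Nontrivial G := by
    by_contra hc
    rw [not_nontrivial_iff_subsingleton] at hc
    exact hgen.no_fixed_vertex ⟨v, fun g => by rw [Subsingleton.elim g 1, one_smul]⟩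
  have hPrieto' : ∀ n, T.Adj v n → IsPrieto (edgeStabilizer G s(v, n)) := fun n hn =>
    hPrieto _ ⟨hn, Sym2.mem_mk_left _ _⟩
  obtain ⟨X, hX⟩ := Group.fg_def.1 hG
  refine ⟨hord, X, X.finite_toSet, hX, fun P hP K hK r _ => ?_⟩
  obtain ⟨E, hE, hEinv, hEr⟩ := exists_finite_of_edist_le X.finite_toSet r
  obtain ⟨a₁, b₁, a₂, b₂, hadj₁, hadj₂, hsep⟩ :=
    hT.exists_separated_halfTrees hn₀ hHucha hPrieto' hP hE hEinv
  have hdisc : ∀ A₁ A₂ : Set G, (∀ x ∈ A₁, x • v ∈ halfTree T a₁ b₁) →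
      (∀ x ∈ A₂, x • v ∈ halfTree T a₂ b₂) →
      RDisconnects (SimpleGraph.mulCayley (X : Set G)) r P⁻¹ A₁ A₂ :=
    fun A₁ A₂ h₁ h₂ n γ hγ h0 hn =>
      hsep n γ (fun i hi => hEr _ _ (hγ i hi)) (h₁ _ h0) (h₂ _ hn)
  obtain ⟨u, hu, huv⟩ := hT.exists_pos_smul_mem_halfTree hmin hgen.no_fixed_end hP v hadj₁
  obtain ⟨w, hw, hwv⟩ := hT.exists_pos_smul_mem_halfTree hmin hgen.no_fixed_end hP v hadj₂
  obtain ⟨A, hA, hAne, hAproper, hKA⟩ : ∃ A : Set V, IsGeodesicallyConvex T A ∧ A.Nonempty ∧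
      A ≠ Set.univ ∧ ∀ g ∈ K, ∀ x ∈ A, g • x ∈ A :=
    hK.elim (hT.exists_convex_of_isCyclic hgen K) (hT.exists_convex_of_actsElliptically hgen K)
  obtain ⟨g₁, hg₁⟩ := hT.exists_coset_smul_mem_halfTree hmin hgen.no_fixed_end hA hAne hAproper
    hKA v hadj₁
  obtain ⟨g₂, hg₂⟩ := hT.exists_coset_smul_mem_halfTree hmin hgen.no_fixed_end hA hAne hAproper
    hKA v hadj₂
  refine ⟨P⁻¹, subset_rfl, ⟨u, hu, w, hw, hdisc _ _ ?_ ?_⟩, ⟨g₁, g₂, hdisc _ _ ?_ ?_⟩⟩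
  · rintro _ rfl
    exact huv
  · rintro _ rfl
    exact hwv
  · rintro _ ⟨k, hk, rfl⟩
    exact hg₁ k hk
  · rintro _ ⟨k, hk, rfl⟩
    exact hg₂ k hk
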